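/- Let $\varphi$ be the Euler function and let $a,b$ be integers with $1\le a\le b$. For $N\ge 1$ let $$I_N=\{(m,n)\in\mathbb N^2:\ 0<m,n\le N,\ m\ne n,\ m\equiv n\equiv a \pmod b\},\qquad \tilde{\mathcal R}_N=\sum_{(m,n)\in I_N}\varphi(m)\varphi(n)\,\Delta_{N(\ln m-\ln n)},$$ where $\Delta_z$ is the unit Dirac mass at $z\in\mathbb R$. For $k\ge 1$ let $$c_{a,b,k}=\frac1b\prod_{p:\ (p,b)\mid k+a}\Big(1-\frac{(p,b)}{p^2}\Big)\prod_{p:\ (p,b)\mid a}\Big(1-(p,b)\,\frac{\kappa_{a,b,k}(p)\,\kappa'_k(p)}{p^2}\Big),$$ the products being over primes $p$, where $(p,b)$ is the gcd, $\kappa_{a,b,k}(p)=\big(1-\frac{(p,b)}{p^2}\big)^{-1}$ if $(p,b)\mid a+k$ and $1$ otherwise, and $\kappa'_k(p)=1-\frac1p$ if $p\mid k$ and $1$ otherwise. Let $$g_{a,b}(s)=\frac1{s^4}\sum_{1\le k\le |s|,\ b\mid k}c_{a,b,k}\,k^3\qquad(s\in\mathbb R),$$ which is $0$ for $|s|<1$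 (empty sum). (1) As $N\to+\infty$, the measures $\frac1{N^3}\tilde{\mathcal R}_N$ on $\mathbb R$ weak-star converge (that is, against every continuous compactly supported function) to the locally finite measure $g_{a,b}(s)\,ds$. (2) For every $b\ge 1$ there is a constant $C$ depending only on $b$ such that, for all $a\in\{1,\dots,b\}$, all real $A\ge 1$ and all $\alpha\in[\frac12,1[$, there is $N_0$ (depending on $a,b,A,\alpha$) such that, for every $C^1$ function $f:\mathbb R\to\mathbb C$ with support contained in $[-A,A]$ and every $N\ge N_0$, $$\Big|\frac1{N^3}\tilde{\mathcal R}_N(f)-\int_{\mathbb R}f(s)\,g_{a,b}(s)\,ds\Big|\le C\Big(\frac{A^7\ln^2N}{N^{1-\alpha}}\|f\|_\infty+\frac{A^3}{N^\alpha}\|f'\|_\infty\Big).$$ (3) If $a=b=1$, then for every $k\ge1$ $$c_{1,1,k}=\prod_{p}\Big(1-\frac2{p^2}\Big)\prod_{p\mid k}\Big(1+\frac1{p(p^2-2)}\Big),$$ and the measures $\frac1{N^3}\tilde{\mathcal R}_N$ weak-star converge to the measure with density $$s\mapsto\frac1{s^4}\prod_{p}\Big(1-\frac2{p^2}\Big)\sum_{k=1}^{\lfloor|s|\rfloor}k^3\prod_{p\mid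 k}\Big(1+\frac1{p(p^2-2)}\Big)$$ with respect to the Lebesgue measure, the products being over primes $p$. -/

import Mathlib

open MeasureTheory Filter Topology
open scoped NNReal ENNReal

noncomputable section

namespace LogPairs

/-- The index set `I_N`: pairs `(m, n)` of distinct integers in `[1, N]`,
both congruent to `a` modulo `b`. -/
def indexPairs (a b N : ℕ) : Finset (ℕ × ℕ) :=
  (Finset.Icc 1 N ×ˢ Finset.Icc 1 N).filter
    (fun x => x.1 ≠ x.2 ∧ x.1 ≡ a [MOD b] ∧ x.2 ≡ a [MOD b])

/-- The (not normalised) pair correlation measure at time `N`, with multiplicities given by the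
Euler function and with scaling `N`: the sum of `φ(m) φ(n)` times the unit Dirac mass at
`N (ln m - ln n)`, over `(m, n) ∈ I_N`. -/
def pairCorrMeasure (a b N : ℕ) : Measure ℝ :=
  ∑ x ∈ indexPairs a b N,
    ((Nat.totient x.1 : ℝ≥0) * (Nat.totient x.2 : ℝ≥0)) •
      Measure.dirac ((N : ℝ) * (Real.log x.1 - Real.log x.2))

/-- The pair correlation measure at time `N`, renormalised by `1 / N ^ 3`. -/
def normPairCorrMeasure (a b N : ℕ) : Measure ℝ :=
  ((N : ℝ≥0) ^ 3)⁻¹ • pairCorrMeasure a b N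

/-- The local factor `κ_{a,b,k}(p)`. -/
def kappa (a b k p : ℕ) : ℝ :=
  if Nat.gcd p b ∣ a + k then (1 - (Nat.gcd p b : ℝ) / (p : ℝ) ^ 2)⁻¹ else 1

/-- The local factor `κ'_k(p)`. -/
def kappa' (k p : ℕ) : ℝ :=
  if p ∣ k then 1 - 1 / (p : ℝ) else 1

/-- The constant `c_{a,b,k}`, a product of two (absolutely convergent) products over the primes
`p` with `(p, b) ∣ k + a`, respectively with `(p, b) ∣ a`. -/
def mirskyConst (a b k : ℕ) : ℝ :=
  1 / (b : ℝ) *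
    (∏' p : Nat.Primes,
      if Nat.gcd p b ∣ k + a then 1 - (Nat.gcd p b : ℝ) / (p : ℝ) ^ 2 else 1) *
    (∏' p : Nat.Primes,
      if Nat.gcd p b ∣ a then
        1 - (Nat.gcd p b : ℝ) * (kappa a b k p * kappa' k p / (p : ℝ) ^ 2) else 1)

/-- The pair correlation function
`s ↦ s⁻⁴ ∑_{1 ≤ k ≤ |s|, b ∣ k} c_{a,b,k} k³` (it vanishes on `]-1, 1[`, the sum being empty). -/
def pairCorrFun (a b : ℕ) (s : ℝ) : ℝ :=
  1 / s ^ 4 * ∑ k ∈ (Finset.Icc 1 ⌊|s|⌋₊).filter (fun k => b ∣ k),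
    mirskyConst a b k * (k : ℝ) ^ 3

/-- Mirsky's constant `∏_p (1 - 2 / p²) ∏_{p ∣ k} (1 + 1 / (p (p² - 2)))`. -/
def mirskyProduct (k : ℕ) : ℝ :=
  (∏' p : Nat.Primes, (1 - 2 / (p : ℝ) ^ 2)) *
    ∏ p ∈ k.primeFactors, (1 + 1 / ((p : ℝ) * ((p : ℝ) ^ 2 - 2)))

/-- The measure on `ℝ` with density `g ≥ 0` with respect to the Lebesgue measure. -/
def densityMeasure (g : ℝ → ℝ) : Measure ℝ :=
  volume.withDensity (fun s => ENNReal.ofReal (g s))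

/-- Weak-star convergence of a sequence of locally finite positive Borel measures on `ℝ` towards
a locally finite one, tested against the continuous functions with compact support. -/
def WeakStarTendsto (μ : ℕ → Measure ℝ) (ν : Measure ℝ) : Prop :=
  (∀ N, IsLocallyFiniteMeasure (μ N)) ∧ IsLocallyFiniteMeasure ν ∧
    ∀ f : ℝ → ℂ, Continuous f → HasCompactSupport f →
      Tendsto (fun N => ∫ x, f x ∂(μ N)) atTop (𝓝 (∫ x, f x ∂ν))

end LogPairs

end

/-!
Why the theorem holds. The points `N log n` with `n ≤ N` are at mutual distance at least the
difference of the integers (`sub_le_mul_log_sub_log`), so a test function supported in `[-A, A]`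
only sees the pairs `(n + k, n)` and `(n, n + k)` with `1 ≤ k ≤ A` and `b ∣ k`. For a fixed `k`,
`N log (1 + k / n)` is `N k / n` up to `N (k / n) ^ 2`, and the sum of `φ(n) φ(n + k) f(N k / n)` is
obtained by partial summation (`norm_sum_mul_sub_le`) from the mean value of
`φ(n) φ(n + k) / (n (n + k))` along `n ≡ a [MOD b]`; the change of variable `s = N k / x` turns
`c_k ∫ x ^ 2 f(N k / x) dx` into `N ^ 3 c_k k ^ 3 ∫ f(s) / s ^ 4 ds`
(`norm_corrSum_sub_integral_le`).

The mean value is handled in two independent ways. Its error term `O(log ^ 2 N)` comes from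
`φ(n) / n = ∑_{d ∣ n} μ(d) / d`: opening both factors yields a double series over `d, e`, each term
of which counts integers in at most one residue class modulo `lcm(b, d, e)`, and which converges
like `∑ 1 / (d e) ^ 2` since `gcd(d, e) ∣ k` (`exists_abs_totientRatioSum_sub_le`). The sum of this
series is not computed directly: the mean value is `mirskyConst` because the residues modulo
distinct primes are independent along a progression (`tendsto_mean_prod`), the local means are the
local factors of `mirskyConst` (`localMean_primeFactorTerm`), and the primes outside a large finite
set contribute little (`tendsto_mean_totientRatioProd`).

For `f` of class `C ^ 1` supported in `[-A, A]` the resulting error is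
`O_{a, b, A} (log ^ 2 N / N) (‖f‖ + ‖f'‖)`. Since `N₀` may depend on `a, b, A, α`, since
`N ^ (1 - α) = o(N)`, and since `log ^ 2 N / N = o(N ^ (-α))`, this is stronger than the stated
error term. Continuous test functions follow by uniform approximation, the measures having bounded
mass on compact sets.
-/

namespace LogPairs

/-! ### Counting in arithmetic progressions -/

lemma abs_card_modEq_sub_le (N r : ℕ) {q : ℕ} (hq : 0 < q) :
    |((((Finset.Icc 1 N).filter (fun n => n ≡ r [MOD q])).card : ℕ) : ℝ) - N / q| ≤ 1 := by
  have hIcc : Finset.Icc 1 N = Finset.Ioc 0 N := by ext; simp; omega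
  have h := Nat.Ioc_filter_modEq_card 0 N hq r
  rw [hIcc]
  set c := ((Finset.Ioc 0 N).filter (fun n => n ≡ r [MOD q])).card with hc
  have hq' : (0 : ℚ) < q := by exact_mod_cast hq
  have e : ((N : ℚ) - r) / q = (((0 : ℕ) : ℚ) - r) / q + N / q := by field_simp; simp; ring
  have hN : (0 : ℚ) ≤ N / q := by positivity
  have h1 := Int.floor_le (((N : ℚ) - r) / q)
  have h2 := Int.lt_floor_add_one (((N : ℚ) - r) / q)
  have h3 := Int.floor_le ((((0 : ℕ) : ℚ) - r) / q)
  have h4 := Int.lt_floor_add_one ((((0 : ℕ) : ℚ) - r) / q)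
  have hmono : ⌊(((0 : ℕ) : ℚ) - r) / q⌋ ≤ ⌊((N : ℚ) - r) / q⌋ :=
    Int.floor_le_floor (by rw [e]; linarith)
  rw [max_eq_left (by linarith)] at h
  have hcq : (c : ℚ) = (⌊((N : ℚ) - r) / q⌋ : ℚ) - (⌊(((0 : ℕ) : ℚ) - r) / q⌋ : ℚ) := by
    exact_mod_cast h
  have key : |(c : ℚ) - N / q| ≤ 1 := by
    rw [abs_le]; constructor <;> linarith
  have : (((|(c : ℚ) - N / q|) : ℚ) : ℝ) ≤ ((1 : ℚ) : ℝ) := by exact_mod_cast key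
  simpa using this

lemma tendsto_card_modEq_div (r : ℕ) {q : ℕ} (hq : 0 < q) :
    Tendsto (fun N : ℕ =>
      ((((Finset.Icc 1 N).filter (fun n => n ≡ r [MOD q])).card : ℕ) : ℝ) / N) atTop
      (𝓝 (1 / q)) := by
  have h0 : Tendsto (fun N : ℕ => (1 : ℝ) / N) atTop (𝓝 0) :=
    tendsto_const_div_atTop_nhds_zero_nat 1
  refine tendsto_iff_norm_sub_tendsto_zero.2 (squeeze_zero' (.of_forall fun _ => norm_nonneg _) ?_ h0)
  filter_upwards [eventually_gt_atTop 0] with N hN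
  have hN' : (0 : ℝ) < N := by exact_mod_cast hN
  have hq' : (0 : ℝ) < q := by exact_mod_cast hq
  have := abs_card_modEq_sub_le N r hq
  have e : ∀ c : ℝ, c / N - 1 / q = (c - N / q) / N := fun c => by field_simp
  rw [Real.norm_eq_abs, e, abs_div, abs_of_pos hN']
  exact div_le_div_of_nonneg_right this hN'.le

/-- The mean of a function of `n mod p` along the progression `n ≡ r [MOD q]`, for a prime `p`:
this progression is contained in a residue class modulo `p` if `p ∣ q`, and is equidistributed
modulo `p` otherwise. -/
noncomputable def localMean (w : ℕ → ℝ) (p q r : ℕ) : ℝ :=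
  if p ∣ q then w r else 1 / p * ∑ j ∈ Finset.range p, w j

/-- Independence of the residues modulo distinct primes along an arithmetic progression. -/
lemma tendsto_mean_prod (w : ℕ → ℕ → ℝ)
    (hw : ∀ p m n, m ≡ n [MOD p] → w p m = w p n) (S : Finset ℕ) :
    (∀ p ∈ S, p.Prime) → ∀ q r : ℕ, 0 < q →
    Tendsto (fun N : ℕ =>
      (∑ n ∈ (Finset.Icc 1 N).filter (fun n => n ≡ r [MOD q]), ∏ p ∈ S, w p n) / N) atTop
      (𝓝 (1 / q * ∏ p ∈ S, localMean (w p) p q r)) := by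
  classical
  induction S using Finset.induction_on with
  | empty => intro _ q r hq; simpa using tendsto_card_modEq_div r hq
  | insert p S hpS ih =>
    intro hS q r hq
    have hp : p.Prime := hS p (by simp)
    have hS' : ∀ p' ∈ S, p'.Prime := fun p' h => hS p' (by simp [h])
    by_cases hpq : p ∣ q
    · have h := (ih hS' q r hq).const_mul (w p r)
      refine (h.congr fun N => ?_).trans_eq ?_
      · rw [← mul_div_assoc, Finset.mul_sum]
        congr 1
        refine Finset.sum_congr rfl fun n hn => ?_
        rw [Finset.prod_insert hpS]
        rw [hw p n r ((Finset.mem_filter.1 hn).2.of_dvd hpq)]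
      · rw [Finset.prod_insert hpS, localMean, if_pos hpq]
        congr 1; ring
    · have hcop : p.Coprime q := (Nat.Prime.coprime_iff_not_dvd hp).2 hpq
      -- the class `j mod p` cuts the progression into a progression modulo `q * p`
      let ρ : ℕ → ℕ := fun j => (Nat.chineseRemainder hcop.symm r j : ℕ)
      have hρq : ∀ j, ρ j ≡ r [MOD q] := fun j => (Nat.chineseRemainder hcop.symm r j).2.1
      have hρp : ∀ j, ρ j ≡ j [MOD p] := fun j => (Nat.chineseRemainder hcop.symm r j).2.2
      have h := tendsto_finsetSum (Finset.range p) fun j _ =>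
        ((ih hS' (q * p) (ρ j) (Nat.mul_pos hq hp.pos)).const_mul (w p j))
      refine (h.congr fun N => ?_).trans_eq ?_
      · have hfib := Finset.sum_fiberwise_of_maps_to
          (s := (Finset.Icc 1 N).filter (fun n => n ≡ r [MOD q])) (t := Finset.range p)
          (g := fun n => n % p) (fun n _ => Finset.mem_range.2 (Nat.mod_lt _ hp.pos))
          (fun n => ∏ p' ∈ insert p S, w p' n)
        rw [← hfib, Finset.sum_div]
        refine Finset.sum_congr rfl fun j hj => ?_
        rw [← mul_div_assoc, Finset.mul_sum]
        congr 1
        have hset : (Finset.Icc 1 N).filter (fun n => n ≡ ρ j [MOD q * p]) =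
            ((Finset.Icc 1 N).filter (fun n => n ≡ r [MOD q])).filter (fun n => n % p = j) := by
          ext n
          simp only [Finset.mem_filter, and_assoc, and_congr_right_iff]
          intro _
          rw [← Nat.modEq_and_modEq_iff_modEq_mul hcop.symm]
          have hjp : j % p = j := Nat.mod_eq_of_lt (Finset.mem_range.1 hj)
          constructor
          · rintro ⟨h1, h2⟩
            exact ⟨h1.trans (hρq j), by have := h2.trans (hρp j); rwa [Nat.ModEq, hjp] at this⟩
          · rintro ⟨h1, h2⟩
            refine ⟨h1.trans (hρq j).symm, Nat.ModEq.trans ?_ (hρp j).symm⟩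
            rw [Nat.ModEq, hjp, h2]
        rw [hset]
        refine Finset.sum_congr rfl fun n hn => ?_
        rw [Finset.prod_insert hpS]
        congr 1
        apply hw
        have := (Finset.mem_filter.1 hn).2
        rw [Nat.ModEq, this, Nat.mod_eq_of_lt (Finset.mem_range.1 hj)]
      · congr 1
        have hloc : ∀ j, ∏ p' ∈ S, localMean (w p') p' (q * p) (ρ j) =
            ∏ p' ∈ S, localMean (w p') p' q r := by
          intro j
          refine Finset.prod_congr rfl fun p' hp' => ?_
          have hne : p' ≠ p := fun h => hpS (h ▸ hp')
          have hiff : p' ∣ q * p ↔ p' ∣ q := by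
            rw [(hS' p' hp').dvd_mul, Nat.prime_dvd_prime_iff_eq (hS' p' hp') hp]
            simp [hne]
          unfold localMean
          by_cases hd : p' ∣ q
          · rw [if_pos (hiff.2 hd), if_pos hd]
            exact hw _ _ _ ((hρq j).of_dvd hd)
          · rw [if_neg (fun h => hd (hiff.1 h)), if_neg hd]
        simp only [hloc]
        rw [← Finset.sum_mul, Finset.prod_insert hpS]
        conv_rhs => rw [localMean, if_neg hpq]
        push_cast
        have : (q : ℝ) ≠ 0 := by positivity
        have : (p : ℝ) ≠ 0 := by exact_mod_cast hp.ne_zero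
        field_simp

/-! ### The mean value of `φ(n) φ(n + k) / (n (n + k))` along a progression -/

/-- The product `φ(n) φ(n + k) / (n (n + k))`, a number in `[0, 1]` when `n ≥ 1`. -/
noncomputable def totientRatioProd (k n : ℕ) : ℝ :=
  (Nat.totient n / n : ℝ) * (Nat.totient (n + k) / ((n + k : ℕ) : ℝ))

/-- The contribution of the prime `p` to `φ(n) φ(n + k) / (n (n + k))`. -/
noncomputable def primeFactorTerm (k p n : ℕ) : ℝ :=
  (if p ∣ n then 1 - 1 / (p : ℝ) else 1) * (if p ∣ n + k then 1 - 1 / (p : ℝ) else 1)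

lemma primeFactorTerm_congr (k p m n : ℕ) (h : m ≡ n [MOD p]) :
    primeFactorTerm k p m = primeFactorTerm k p n := by
  unfold primeFactorTerm
  have h1 : (p ∣ m) ↔ p ∣ n := (h.dvd_iff dvd_rfl)
  have h2 : (p ∣ m + k) ↔ p ∣ n + k := ((h.add_right k).dvd_iff dvd_rfl)
  simp only [h1, h2]

lemma one_sub_inv_mem {p : ℕ} (hp : p.Prime) :
    0 ≤ 1 - 1 / (p : ℝ) ∧ 1 - 1 / (p : ℝ) ≤ 1 := by
  have : (1 : ℝ) ≤ p := by exact_mod_cast hp.one_lt.le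
  have h1 : 1 / (p : ℝ) ≤ 1 := by rw [div_le_one (by linarith)]; exact this
  have h2 : 0 ≤ 1 / (p : ℝ) := by positivity
  constructor <;> linarith

lemma primeFactorTerm_nonneg (k n : ℕ) {p : ℕ} (hp : p.Prime) : 0 ≤ primeFactorTerm k p n := by
  have := one_sub_inv_mem hp
  unfold primeFactorTerm
  split_ifs <;> nlinarith

lemma primeFactorTerm_le_one (k n : ℕ) {p : ℕ} (hp : p.Prime) : primeFactorTerm k p n ≤ 1 := by
  have := one_sub_inv_mem hp
  unfold primeFactorTerm
  split_ifs <;> nlinarith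

lemma one_sub_primeFactorTerm_le (k n : ℕ) {p : ℕ} (hp : p.Prime) :
    1 - primeFactorTerm k p n ≤
      1 / (p : ℝ) * ((if p ∣ n then 1 else 0) + (if p ∣ n + k then 1 else 0)) := by
  have := one_sub_inv_mem hp
  have h2 : 0 ≤ 1 / (p : ℝ) := by positivity
  unfold primeFactorTerm
  split_ifs <;> nlinarith

lemma totient_div_eq_prod {n : ℕ} (hn : 0 < n) (S : Finset Nat.Primes)
    (hS : ∀ p : Nat.Primes, (p : ℕ) ∣ n → p ∈ S) :
    (Nat.totient n / n : ℝ) = ∏ p ∈ S, (if (p : ℕ) ∣ n then 1 - 1 / ((p : ℕ) : ℝ) else 1) := by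
  have h := congrArg (fun x : ℚ => (x : ℝ)) (Nat.totient_eq_mul_prod_factors n)
  push_cast at h
  have hn' : (n : ℝ) ≠ 0 := by positivity
  rw [h, mul_div_cancel_left₀ _ hn', ← Finset.prod_filter]
  symm
  refine Finset.prod_bij (fun p _ => (p : ℕ)) ?_ ?_ ?_ ?_
  · intro p hp
    exact Nat.mem_primeFactors.2 ⟨p.2, (Finset.mem_filter.1 hp).2, hn.ne'⟩
  · intro p _ q _ h
    exact Subtype.ext h
  · intro p hp
    obtain ⟨h1, h2, _⟩ := Nat.mem_primeFactors.1 hp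
    exact ⟨⟨p, h1⟩, Finset.mem_filter.2 ⟨hS ⟨p, h1⟩ h2, h2⟩, rfl⟩
  · intro p _
    simp

lemma totientRatioProd_eq_prod (k : ℕ) {n : ℕ} (hn : 0 < n) (S : Finset Nat.Primes)
    (hS : ∀ p : Nat.Primes, (p : ℕ) ≤ n + k → p ∈ S) :
    totientRatioProd k n = ∏ p ∈ S, primeFactorTerm k p n := by
  unfold totientRatioProd primeFactorTerm
  rw [Finset.prod_mul_distrib,
    totient_div_eq_prod hn S fun p hp => hS p ((Nat.le_of_dvd hn hp).trans (Nat.le_add_right _ _)),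
    totient_div_eq_prod (n := n + k) (by omega) S
      fun p hp => hS p (Nat.le_of_dvd (by omega) hp)]

lemma one_sub_sum_le_prod {ι : Type*} (S : Finset ι) (w : ι → ℝ) (h0 : ∀ i ∈ S, 0 ≤ w i)
    (h1 : ∀ i ∈ S, w i ≤ 1) : 1 - ∑ i ∈ S, (1 - w i) ≤ ∏ i ∈ S, w i := by
  classical
  induction S using Finset.induction_on with
  | empty => simp
  | insert i S hi ih =>
    rw [Finset.sum_insert hi, Finset.prod_insert hi]
    have hi0 := h0 i (by simp)
    have hi1 := h1 i (by simp)
    have ih' := ih (fun j hj => h0 j (by simp [hj])) (fun j hj => h1 j (by simp [hj]))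
    have hs : 0 ≤ ∑ j ∈ S, (1 - w j) :=
      Finset.sum_nonneg fun j hj => by linarith [h1 j (by simp [hj])]
    nlinarith

lemma abs_prod_sub_prod_le {ι : Type*} [DecidableEq ι] {S S' : Finset ι} (hSS : S ⊆ S')
    (w : ι → ℝ) (h0 : ∀ i, 0 ≤ w i) (h1 : ∀ i, w i ≤ 1) :
    |∏ i ∈ S', w i - ∏ i ∈ S, w i| ≤ ∑ i ∈ S' \ S, (1 - w i) := by
  rw [← Finset.prod_sdiff hSS]
  have a := one_sub_sum_le_prod (S' \ S) w (fun i _ => h0 i) (fun i _ => h1 i)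
  have b : ∏ i ∈ S' \ S, w i ≤ 1 := Finset.prod_le_one (fun i _ => h0 i) (fun i _ => h1 i)
  have c : ∏ i ∈ S, w i ≤ 1 := Finset.prod_le_one (fun i _ => h0 i) (fun i _ => h1 i)
  have d : 0 ≤ ∏ i ∈ S, w i := Finset.prod_nonneg fun i _ => h0 i
  rw [abs_le]
  constructor <;> nlinarith

lemma sum_dvd_add_le (N k p : ℕ) :
    ∑ n ∈ Finset.Icc 1 N, (if p ∣ n + k then (1 : ℝ) else 0) ≤ (N + k) / p := by
  have h1 : ∑ n ∈ Finset.Icc 1 N, (if p ∣ n + k then (1 : ℝ) else 0) =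
      (((Finset.Icc 1 N).filter (fun n => p ∣ n + k)).card : ℝ) := by
    rw [Finset.sum_boole]
  have h2 : ((Finset.Icc 1 N).filter (fun n => p ∣ n + k)).card ≤ (N + k) / p := by
    rw [← Nat.Ioc_filter_dvd_card_eq_div]
    refine Finset.card_le_card_of_injOn (fun n => n + k) ?_ (fun _ _ _ _ h => by simpa using h)
    intro n hn
    simp only [Finset.coe_filter, Finset.mem_Icc, Set.mem_ofPred_eq, Finset.mem_Ioc] at hn ⊢
    exact ⟨⟨by omega, by omega⟩, hn.2⟩
  rw [h1]
  calc (((Finset.Icc 1 N).filter (fun n => p ∣ n + k)).card : ℝ) ≤ (((N + k) / p : ℕ) : ℝ) := by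
        exact_mod_cast h2
    _ ≤ ((N + k : ℕ) : ℝ) / p := Nat.cast_div_le
    _ = _ := by push_cast; rfl

/-- Only the primes outside `S` are lost when `φ(n) φ(n + k) / (n (n + k))` is replaced by its
`S`-part, and such a prime `p` costs `O(1 / p ^ 2)` on average. -/
lemma sum_abs_totientRatioProd_sub_le (k N : ℕ) (S : Finset Nat.Primes) :
    ∃ R : Finset Nat.Primes, Disjoint R S ∧
      ∑ n ∈ Finset.Icc 1 N, |totientRatioProd k n - ∏ p ∈ S, primeFactorTerm k p n| ≤
        2 * (N + k) * ∑ p ∈ R, 1 / (((p : ℕ) : ℝ) ^ 2) := by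
  classical
  let Q : Finset Nat.Primes := (Finset.Icc 1 (N + k)).subtype Nat.Prime
  have hQ : ∀ p : Nat.Primes, (p : ℕ) ≤ N + k → p ∈ S ∪ Q := fun p hp =>
    Finset.mem_union_right _ (Finset.mem_subtype.2 (Finset.mem_Icc.2 ⟨p.2.one_lt.le, hp⟩))
  refine ⟨(S ∪ Q) \ S, Finset.sdiff_disjoint, ?_⟩
  calc ∑ n ∈ Finset.Icc 1 N, |totientRatioProd k n - ∏ p ∈ S, primeFactorTerm k p n|
      ≤ ∑ n ∈ Finset.Icc 1 N, ∑ p ∈ (S ∪ Q) \ S, 1 / ((p : ℕ) : ℝ) *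
          ((if (p : ℕ) ∣ n + 0 then 1 else 0) + (if (p : ℕ) ∣ n + k then 1 else 0)) := by
        refine Finset.sum_le_sum fun n hn => ?_
        have hn' := Finset.mem_Icc.1 hn
        rw [totientRatioProd_eq_prod k hn'.1 (S ∪ Q) fun p hp => hQ p (by omega)]
        refine (abs_prod_sub_prod_le Finset.subset_union_left _
          (fun p => primeFactorTerm_nonneg k n p.2)
          (fun p => primeFactorTerm_le_one k n p.2)).trans ?_
        exact Finset.sum_le_sum fun p _ => one_sub_primeFactorTerm_le k n p.2
    _ = ∑ p ∈ (S ∪ Q) \ S, 1 / ((p : ℕ) : ℝ) *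
          (∑ n ∈ Finset.Icc 1 N, (if (p : ℕ) ∣ n + 0 then 1 else 0) +
            ∑ n ∈ Finset.Icc 1 N, (if (p : ℕ) ∣ n + k then 1 else 0)) := by
        rw [Finset.sum_comm]
        refine Finset.sum_congr rfl fun p _ => ?_
        rw [← Finset.mul_sum, Finset.sum_add_distrib]
    _ ≤ ∑ p ∈ (S ∪ Q) \ S, 2 * (N + k) * (1 / (((p : ℕ) : ℝ) ^ 2)) := by
        refine Finset.sum_le_sum fun p _ => ?_
        have hp : (0 : ℝ) < ((p : ℕ) : ℝ) := by exact_mod_cast p.2.pos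
        have h1 := sum_dvd_add_le N 0 p
        have h2 := sum_dvd_add_le N k p
        have h3 : ((N : ℝ) + (0 : ℕ)) / ((p : ℕ) : ℝ) ≤ ((N : ℝ) + k) / ((p : ℕ) : ℝ) := by
          gcongr; simp
        have e : 2 * ((N : ℝ) + k) * (1 / (((p : ℕ) : ℝ) ^ 2)) =
            1 / ((p : ℕ) : ℝ) * (((N : ℝ) + k) / ((p : ℕ) : ℝ) + ((N : ℝ) + k) / ((p : ℕ) : ℝ)) := by
          field_simp; ring
        rw [e]
        gcongr
        exact h1.trans h3
    _ = _ := by rw [Finset.mul_sum]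

lemma summable_primes_inv_sq : Summable fun p : Nat.Primes => 1 / (((p : ℕ) : ℝ) ^ 2) := by
  have h : Summable fun n : ℕ => 1 / ((n : ℝ) ^ 2) := Real.summable_one_div_nat_pow.2 one_lt_two
  exact h.comp_injective (i := fun p : Nat.Primes => (p : ℕ)) Subtype.val_injective

/-! ### The Euler product -/

lemma sum_primeFactorTerm (k : ℕ) {p : ℕ} (hp : p.Prime) :
    1 / (p : ℝ) * ∑ j ∈ Finset.range p, primeFactorTerm k p j =
      1 - 2 / (p : ℝ) ^ 2 + (if p ∣ k then 1 / (p : ℝ) ^ 3 else 0) := by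
  obtain ⟨i, hi, hik⟩ : ∃ i ∈ Finset.range p, ∀ j ∈ Finset.range p, p ∣ j + k ↔ j = i := by
    refine ⟨(p - k % p) % p, Finset.mem_range.2 (Nat.mod_lt _ hp.pos), fun j hj => ?_⟩
    have hj' := Finset.mem_range.1 hj
    have hk := Nat.mod_lt k hp.pos
    rw [Nat.dvd_iff_mod_eq_zero, Nat.add_mod, Nat.mod_eq_of_lt hj']
    rcases Nat.eq_zero_or_pos (k % p) with h | h
    · rw [h]; simp [Nat.mod_eq_of_lt hj']
    · rw [Nat.mod_eq_of_lt (show p - k % p < p by omega)]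
      constructor
      · intro h'
        obtain ⟨c, hc⟩ := Nat.dvd_of_mod_eq_zero h'
        have : c < 2 := by
          by_contra hcon
          have : p * 2 ≤ p * c := Nat.mul_le_mul_left p (by omega)
          omega
        interval_cases c <;> omega
      · intro h'
        rw [show j + k % p = p by omega, Nat.mod_self]
  have h0 : ∀ j ∈ Finset.range p, p ∣ j ↔ j = 0 := fun j hj =>
    ⟨fun h => Nat.eq_zero_of_dvd_of_lt h (Finset.mem_range.1 hj), fun h => h ▸ dvd_zero p⟩
  have h0p : (0 : ℕ) ∈ Finset.range p := Finset.mem_range.2 hp.pos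
  have hk0 : p ∣ k ↔ 0 = i := by simpa using hik 0 h0p
  have hterm : ∀ j ∈ Finset.range p, primeFactorTerm k p j =
      1 - (if j = 0 then 1 / (p : ℝ) else 0) - (if j = i then 1 / (p : ℝ) else 0) +
        (if j = 0 then (if p ∣ k then 1 / (p : ℝ) ^ 2 else 0) else 0) := by
    intro j hj
    unfold primeFactorTerm
    simp only [h0 j hj, hik j hj, hk0]
    by_cases h1 : j = 0
    · subst h1
      by_cases h2 : 0 = i
      · simp [h2]; ring
      · simp [h2]
    · by_cases h2 : j = i
      · subst h2
        simp [h1]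
      · simp [h1, h2]
  rw [Finset.sum_congr rfl hterm]
  simp only [Finset.sum_add_distrib, Finset.sum_sub_distrib, Finset.sum_ite_eq', h0p, hi, if_true]
  have : (p : ℝ) ≠ 0 := by exact_mod_cast hp.ne_zero
  split_ifs <;> simp <;> field_simp <;> ring

/-- The first local factor of `mirskyConst`. -/
noncomputable def mirskyFactor₁ (a b k p : ℕ) : ℝ :=
  if Nat.gcd p b ∣ k + a then 1 - (Nat.gcd p b : ℝ) / (p : ℝ) ^ 2 else 1

/-- The second local factor of `mirskyConst`. -/
noncomputable def mirskyFactor₂ (a b k p : ℕ) : ℝ :=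
  if Nat.gcd p b ∣ a then
    1 - (Nat.gcd p b : ℝ) * (kappa a b k p * kappa' k p / (p : ℝ) ^ 2) else 1

lemma localMean_primeFactorTerm (a b k : ℕ) (hbk : b ∣ k) {p : ℕ} (hp : p.Prime) :
    localMean (primeFactorTerm k p) p b a = mirskyFactor₁ a b k p * mirskyFactor₂ a b k p := by
  have hp2 : (2 : ℝ) ≤ p := by exact_mod_cast hp.two_le
  have hp0 : (p : ℝ) ≠ 0 := by linarith
  unfold localMean mirskyFactor₁ mirskyFactor₂ kappa kappa'
  by_cases hpb : p ∣ b
  · have hg : Nat.gcd p b = p := Nat.gcd_eq_left hpb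
    have hpk : p ∣ k := hpb.trans hbk
    have h1 : (p : ℝ) / (p : ℝ) ^ 2 = 1 / p := by field_simp
    have h2 : 1 - 1 / (p : ℝ) ≠ 0 := by
      have : 1 / (p : ℝ) ≤ 1 / 2 := by gcongr
      linarith
    rw [if_pos hpb, hg, if_pos hpk, h1]
    unfold primeFactorTerm
    have hiff1 : p ∣ a + k ↔ p ∣ a := Nat.dvd_add_left hpk
    have hiff2 : p ∣ k + a ↔ p ∣ a := Nat.dvd_add_right hpk
    simp only [hiff1, hiff2]
    by_cases hpa : p ∣ a
    · simp only [hpa, if_true]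
      rw [inv_mul_cancel₀ h2]
      field_simp
    · simp [hpa]
  · have hg : Nat.gcd p b = 1 := (Nat.Prime.coprime_iff_not_dvd hp).2 hpb
    rw [if_neg hpb, hg, sum_primeFactorTerm k hp]
    have h2 : (p : ℝ) ^ 2 - 1 ≠ 0 := by nlinarith
    simp only [one_dvd, if_true, Nat.cast_one, one_mul]
    have h3 : (1 - 1 / (p : ℝ) ^ 2)⁻¹ = (p : ℝ) ^ 2 / ((p : ℝ) ^ 2 - 1) := by
      rw [← one_div_div, one_div]; field_simp
    rw [h3]
    split_ifs <;> field_simp <;> ring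

lemma gcd_div_sq_le (b : ℕ) {p : ℕ} (hp : p.Prime) :
    0 ≤ (Nat.gcd p b : ℝ) / (p : ℝ) ^ 2 ∧ (Nat.gcd p b : ℝ) / (p : ℝ) ^ 2 ≤ 1 / 2 := by
  have hp2 : (2 : ℝ) ≤ p := by exact_mod_cast hp.two_le
  have hg : (Nat.gcd p b : ℝ) ≤ p := by exact_mod_cast Nat.gcd_le_left b hp.pos
  refine ⟨by positivity, ?_⟩
  rw [div_le_div_iff₀ (by positivity) (by norm_num)]
  nlinarith

lemma multipliable_mirskyFactor (a b k : ℕ) (hb : 0 < b) :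
    Multipliable (fun p : Nat.Primes => mirskyFactor₁ a b k p) ∧
      Multipliable (fun p : Nat.Primes => mirskyFactor₂ a b k p) := by
  have hs : Summable fun p : Nat.Primes => (2 * b : ℝ) * (1 / (((p : ℕ) : ℝ) ^ 2)) :=
    summable_primes_inv_sq.mul_left _
  have hgb : ∀ p : ℕ, Nat.gcd p b ≤ b := fun p => Nat.gcd_le_right p hb
  constructor
  · have h := multipliable_one_add_of_summable
      (f := fun p : Nat.Primes => mirskyFactor₁ a b k p - 1) (hs.of_nonneg_of_le
        (fun _ => norm_nonneg _) fun p => ?_)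
    · simpa using h
    · have h1 := gcd_div_sq_le b p.2
      have h2 : (Nat.gcd p b : ℝ) / ((p : ℕ) : ℝ) ^ 2 ≤ b * (1 / (((p : ℕ) : ℝ) ^ 2)) := by
        rw [div_eq_mul_one_div]; gcongr; exact hgb p
      unfold mirskyFactor₁
      have h3 : 0 ≤ (b : ℝ) * (1 / (((p : ℕ) : ℝ) ^ 2)) := by positivity
      rw [Real.norm_eq_abs, abs_le]
      split_ifs <;> constructor <;> linarith
  · have h := multipliable_one_add_of_summable
      (f := fun p : Nat.Primes => mirskyFactor₂ a b k p - 1) (hs.of_nonneg_of_le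
        (fun _ => norm_nonneg _) fun p => ?_)
    · simpa using h
    · have h1 := gcd_div_sq_le b p.2
      have hk : 0 ≤ kappa a b k p ∧ kappa a b k p ≤ 2 := by
        unfold kappa
        split_ifs
        · refine ⟨inv_nonneg.2 (by linarith), ?_⟩
          rw [inv_le_comm₀ (by linarith) (by norm_num)]
          linarith
        · norm_num
      have hk' : 0 ≤ kappa' k p ∧ kappa' k p ≤ 1 := by
        unfold kappa'
        split_ifs
        · exact one_sub_inv_mem p.2
        · norm_num
      have h0 : 0 ≤ kappa a b k p * kappa' k p := mul_nonneg hk.1 hk'.1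
      have h2 : kappa a b k p * kappa' k p ≤ 2 := by nlinarith
      have h4 : (Nat.gcd p b : ℝ) * (kappa a b k p * kappa' k p / ((p : ℕ) : ℝ) ^ 2) ≤
          b * (2 / ((p : ℕ) : ℝ) ^ 2) := by
        gcongr; exact hgb p
      have h5 : 0 ≤ (Nat.gcd p b : ℝ) * (kappa a b k p * kappa' k p / ((p : ℕ) : ℝ) ^ 2) := by
        positivity
      have e : (b : ℝ) * (2 / ((p : ℕ) : ℝ) ^ 2) = 2 * b * (1 / ((p : ℕ) : ℝ) ^ 2) := by ring
      have h3 : 0 ≤ 2 * (b : ℝ) * (1 / (((p : ℕ) : ℝ) ^ 2)) := by positivity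
      unfold mirskyFactor₂
      rw [Real.norm_eq_abs, abs_le]
      split_ifs <;> constructor <;> linarith

/-- The Euler product of the local means is `mirskyConst`, when `b ∣ k`. -/
lemma tendsto_prod_localMean (a b k : ℕ) (hb : 0 < b) (hbk : b ∣ k) :
    Tendsto (fun S : Finset Nat.Primes =>
      1 / (b : ℝ) * ∏ p ∈ S, localMean (primeFactorTerm k p) p b a) atTop
      (𝓝 (mirskyConst a b k)) := by
  obtain ⟨h1, h2⟩ := multipliable_mirskyFactor a b k hb
  have h := (h1.hasProd.mul h2.hasProd)
  have h' : Tendsto (fun S : Finset Nat.Primes =>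
      ∏ p ∈ S, localMean (primeFactorTerm k p) p b a) atTop
      (𝓝 ((∏' p : Nat.Primes, mirskyFactor₁ a b k p) *
        ∏' p : Nat.Primes, mirskyFactor₂ a b k p)) := by
    refine Tendsto.congr (fun S => ?_) h
    exact Finset.prod_congr rfl fun p _ => (localMean_primeFactorTerm a b k hbk p.2).symm
  have h3 := h'.const_mul (1 / (b : ℝ))
  rw [← mul_assoc] at h3
  exact h3

/-- The mean value of `φ(n) φ(n + k) / (n (n + k))` along `n ≡ a [MOD b]`. -/
lemma tendsto_mean_totientRatioProd (a b k : ℕ) (hb : 0 < b) (hbk : b ∣ k) :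
    Tendsto (fun N : ℕ =>
      (∑ n ∈ (Finset.Icc 1 N).filter (fun n => n ≡ a [MOD b]), totientRatioProd k n) / N) atTop
      (𝓝 (mirskyConst a b k)) := by
  classical
  rw [Metric.tendsto_atTop]
  intro ε hε
  obtain ⟨S₀, hS₀⟩ := summable_iff_vanishing_norm.1 summable_primes_inv_sq (ε / 16) (by positivity)
  obtain ⟨S₁, hS₁⟩ := (Metric.tendsto_atTop.1 (tendsto_prod_localMean a b k hb hbk)) (ε / 4)
    (by positivity)
  let S := S₀ ∪ S₁
  let e : Nat.Primes ↪ ℕ := ⟨fun p => (p : ℕ), Subtype.val_injective⟩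
  have hlim := tendsto_mean_prod (primeFactorTerm k) (primeFactorTerm_congr k)
    (S.map e) (by
      intro p hp
      obtain ⟨q, _, rfl⟩ := Finset.mem_map.1 hp
      exact q.2) b a hb
  have he : ∀ p : Nat.Primes, e p = (p : ℕ) := fun _ => rfl
  simp only [Finset.prod_map, he] at hlim
  obtain ⟨N₀, hN₀⟩ := (Metric.tendsto_atTop.1 hlim) (ε / 4) (by positivity)
  refine ⟨max (max N₀ k) 1, fun N hN => ?_⟩
  have hN1 : N₀ ≤ N := by omega
  have hNk : k ≤ N := by omega
  have hNpos : (0 : ℝ) < N := by exact_mod_cast (show 0 < N by omega)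
  have hA := hN₀ N hN1
  have hB := hS₁ S Finset.subset_union_right
  obtain ⟨R, hR, hsum⟩ := sum_abs_totientRatioProd_sub_le k N S
  have hRsum := hS₀ R (hR.mono_right Finset.subset_union_left)
  have hRsum' : ∑ p ∈ R, 1 / (((p : ℕ) : ℝ) ^ 2) < ε / 16 := (le_abs_self _).trans_lt hRsum
  have hC : |(∑ n ∈ (Finset.Icc 1 N).filter (fun n => n ≡ a [MOD b]), totientRatioProd k n) / N -
      (∑ n ∈ (Finset.Icc 1 N).filter (fun n => n ≡ a [MOD b]),
        ∏ p ∈ S, primeFactorTerm k p n) / N| ≤ ε / 4 := by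
    rw [← sub_div, ← Finset.sum_sub_distrib, abs_div, abs_of_pos hNpos, div_le_iff₀ hNpos]
    refine (Finset.abs_sum_le_sum_abs _ _).trans ?_
    refine (Finset.sum_le_sum_of_subset_of_nonneg (Finset.filter_subset _ _)
      fun _ _ _ => abs_nonneg _).trans ?_
    refine hsum.trans ?_
    have hk' : (k : ℝ) ≤ N := by exact_mod_cast hNk
    have : 2 * ((N : ℝ) + k) * ∑ p ∈ R, 1 / (((p : ℕ) : ℝ) ^ 2) ≤ 2 * ((N : ℝ) + N) * (ε / 16) := by
      gcongr
    linarith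
  rw [Real.dist_eq] at hA hB ⊢
  rw [abs_lt] at *
  rw [abs_le] at hC
  constructor <;> linarith [hA.1, hA.2, hB.1, hB.2, hC.1, hC.2]

/-! ### The error term in the mean value -/

lemma modEq_lcm_iff (m n u v : ℕ) :
    m ≡ n [MOD Nat.lcm u v] ↔ m ≡ n [MOD u] ∧ m ≡ n [MOD v] := by
  simp only [Nat.modEq_iff_dvd, Int.natCast_dvd, Nat.lcm_dvd_iff]

open Classical in
/-- The density of the set of integers `n ≡ a [MOD b]` such that `d ∣ n` and `e ∣ n + k`. -/
noncomputable def congruenceDensity (a b k d e : ℕ) : ℝ :=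
  if ∃ n, n ≡ a [MOD b] ∧ d ∣ n ∧ e ∣ n + k then 1 / (Nat.lcm b (Nat.lcm d e) : ℝ) else 0

lemma abs_card_sub_congruenceDensity_le (a k N : ℕ) {b d e : ℕ} (hb : 0 < b) (hd : 0 < d)
    (he : 0 < e) :
    |((((Finset.Icc 1 N).filter (fun n => n ≡ a [MOD b])).filter
        (fun n => d ∣ n ∧ e ∣ n + k)).card : ℝ) - N * congruenceDensity a b k d e| ≤ 1 := by
  unfold congruenceDensity
  split_ifs with h
  · obtain ⟨n₀, h1, h2, h3⟩ := h
    have hset : ((Finset.Icc 1 N).filter (fun n => n ≡ a [MOD b])).filter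
        (fun n => d ∣ n ∧ e ∣ n + k) =
        (Finset.Icc 1 N).filter (fun n => n ≡ n₀ [MOD Nat.lcm b (Nat.lcm d e)]) := by
      ext n
      simp only [Finset.mem_filter, and_assoc, and_congr_right_iff, modEq_lcm_iff]
      intro _
      constructor
      · rintro ⟨g1, g2, g3⟩
        refine ⟨g1.trans h1.symm, ?_, ?_⟩
        · exact ((Nat.modEq_zero_iff_dvd.2 g2).trans (Nat.modEq_zero_iff_dvd.2 h2).symm)
        · exact Nat.ModEq.add_right_cancel' k
            ((Nat.modEq_zero_iff_dvd.2 g3).trans (Nat.modEq_zero_iff_dvd.2 h3).symm)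
      · rintro ⟨g1, g2, g3⟩
        exact ⟨g1.trans h1, (g2.dvd_iff dvd_rfl).2 h2, ((g3.add_right k).dvd_iff dvd_rfl).2 h3⟩
    rw [hset, mul_one_div]
    exact abs_card_modEq_sub_le N n₀ (Nat.lcm_pos hb (Nat.lcm_pos hd he))
  · have hset : ((Finset.Icc 1 N).filter (fun n => n ≡ a [MOD b])).filter
        (fun n => d ∣ n ∧ e ∣ n + k) = ∅ := by
      refine Finset.filter_eq_empty_iff.2 fun n hn hn' => h ⟨n, ?_, hn'.1, hn'.2⟩
      exact (Finset.mem_filter.1 hn).2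
    rw [hset]
    simp

lemma congruenceDensity_nonneg (a b k d e : ℕ) : 0 ≤ congruenceDensity a b k d e := by
  unfold congruenceDensity
  split_ifs
  · positivity
  · exact le_rfl

/-- The common divisors of `n` and `n + k` divide `k`, so that the conditions `d ∣ n` and
`e ∣ n + k` are almost independent. -/
lemma congruenceDensity_le (a : ℕ) {b k d e : ℕ} (hb : 0 < b) (hk : 0 < k) (hd : 0 < d)
    (he : 0 < e) : congruenceDensity a b k d e ≤ k / (d * e) := by
  unfold congruenceDensity
  split_ifs with h
  · obtain ⟨n, _, h2, h3⟩ := h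
    have hg : Nat.gcd d e ∣ k :=
      (Nat.dvd_add_right ((Nat.gcd_dvd_left d e).trans h2)).1 ((Nat.gcd_dvd_right d e).trans h3)
    have hgk := Nat.le_of_dvd hk hg
    have hL : 0 < Nat.lcm b (Nat.lcm d e) := Nat.lcm_pos hb (Nat.lcm_pos hd he)
    have hle : Nat.lcm d e ≤ Nat.lcm b (Nat.lcm d e) := Nat.le_of_dvd hL (Nat.dvd_lcm_right _ _)
    have key : d * e ≤ k * Nat.lcm b (Nat.lcm d e) := by
      rw [← Nat.gcd_mul_lcm d e]
      exact Nat.mul_le_mul hgk hle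
    rw [div_le_div_iff₀ (by exact_mod_cast hL) (by positivity), one_mul]
    exact_mod_cast key
  · positivity

lemma totient_div_eq_sum_moebius {n D : ℕ} (hn : 0 < n) (hD : n ≤ D) :
    (Nat.totient n / n : ℝ) =
      ∑ d ∈ Finset.Ioc 0 D, (if d ∣ n then (ArithmeticFunction.moebius d : ℝ) / d else 0) := by
  have h := (ArithmeticFunction.sum_eq_iff_sum_mul_moebius_eq (R := ℝ)
    (f := fun n => (Nat.totient n : ℝ)) (g := fun n => (n : ℝ))).1
    (fun m _ => by exact_mod_cast Nat.sum_totient m) n hn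
  rw [Nat.sum_divisorsAntidiagonal
    (f := fun i j => ((ArithmeticFunction.moebius i : ℤ) : ℝ) * (j : ℝ))] at h
  rw [← h, Finset.sum_div, ← Finset.sum_filter]
  have hset : (Finset.Ioc 0 D).filter (fun d => d ∣ n) = n.divisors := by
    ext d
    simp only [Finset.mem_filter, Finset.mem_Ioc, Nat.mem_divisors]
    constructor
    · rintro ⟨_, h⟩; exact ⟨h, hn.ne'⟩
    · rintro ⟨h, _⟩
      exact ⟨⟨Nat.pos_of_dvd_of_pos h hn, (Nat.le_of_dvd hn h).trans hD⟩, h⟩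
  rw [hset]
  refine Finset.sum_congr rfl fun d hd => ?_
  have hdn := Nat.dvd_of_mem_divisors hd
  have hd0 : (d : ℝ) ≠ 0 := by exact_mod_cast (Nat.pos_of_dvd_of_pos hdn hn).ne'
  rw [Nat.cast_div hdn hd0]
  have hn' : (n : ℝ) ≠ 0 := by positivity
  field_simp

/-- A term of the double series for the mean value of `φ(n) φ(n + k) / (n (n + k))`. -/
noncomputable def meanTerm (a b k d e : ℕ) : ℝ :=
  ((ArithmeticFunction.moebius d : ℝ) / d * ((ArithmeticFunction.moebius e : ℝ) / e)) *
    congruenceDensity a b k d e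

lemma abs_moebius_div_le (d : ℕ) : |(ArithmeticFunction.moebius d : ℝ) / d| ≤ 1 / d := by
  rw [abs_div, Nat.abs_cast]
  gcongr
  exact_mod_cast ArithmeticFunction.abs_moebius_le_one

lemma abs_meanTerm_le (a : ℕ) {b k d e : ℕ} (hb : 0 < b) (hk : 0 < k) (hd : 0 < d)
    (he : 0 < e) :
    |meanTerm a b k d e| ≤ k * (((d : ℝ) ^ 2)⁻¹ * ((e : ℝ) ^ 2)⁻¹) := by
  unfold meanTerm
  rw [abs_mul, abs_mul, abs_of_nonneg (congruenceDensity_nonneg a b k d e)]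
  calc _ ≤ 1 / (d : ℝ) * (1 / e) * (k / (d * e)) := by
        gcongr
        · exact congruenceDensity_nonneg a b k d e
        · exact abs_moebius_div_le d
        · exact abs_moebius_div_le e
        · exact congruenceDensity_le a hb hk hd he
    _ = _ := by field_simp

lemma sum_Ioc_inv_sq_le {D D' : ℕ} (hD : 0 < D) (h : D ≤ D') :
    ∑ d ∈ Finset.Ioc D D', ((d : ℝ) ^ 2)⁻¹ ≤ 1 / D := by
  have := sum_Ioc_inv_sq_le_sub (α := ℝ) hD.ne' h
  have h0 : (0 : ℝ) ≤ (D' : ℝ)⁻¹ := by positivity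
  rw [one_div]
  linarith

lemma sum_Ioc_zero_inv_sq_le (D : ℕ) : ∑ d ∈ Finset.Ioc 0 D, ((d : ℝ) ^ 2)⁻¹ ≤ 2 := by
  rcases Nat.eq_zero_or_pos D with rfl | hD
  · simp
  · rw [← Finset.sum_Ioc_consecutive _ (Nat.zero_le 1) hD]
    have := sum_Ioc_inv_sq_le one_pos hD
    simp at this ⊢
    linarith

lemma abs_sum_meanTerm_le (a : ℕ) {b k : ℕ} (hb : 0 < b) (hk : 0 < k) (u v u' v' : ℕ) :
    |∑ d ∈ Finset.Ioc u v, ∑ e ∈ Finset.Ioc u' v', meanTerm a b k d e| ≤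
      k * ((∑ d ∈ Finset.Ioc u v, ((d : ℝ) ^ 2)⁻¹) * ∑ e ∈ Finset.Ioc u' v', ((e : ℝ) ^ 2)⁻¹) := by
  rw [Finset.sum_mul_sum, Finset.mul_sum]
  refine (Finset.abs_sum_le_sum_abs _ _).trans (Finset.sum_le_sum fun d hd => ?_)
  rw [Finset.mul_sum]
  refine (Finset.abs_sum_le_sum_abs _ _).trans (Finset.sum_le_sum fun e he => ?_)
  exact abs_meanTerm_le a hb hk (by have := Finset.mem_Ioc.1 hd; omega)
    (by have := Finset.mem_Ioc.1 he; omega)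

/-- The square partial sums of the double series for the mean value. -/
noncomputable def meanPartialSum (a b k D : ℕ) : ℝ :=
  ∑ d ∈ Finset.Ioc 0 D, ∑ e ∈ Finset.Ioc 0 D, meanTerm a b k d e

lemma abs_meanPartialSum_sub_le (a : ℕ) {b k D D' : ℕ} (hb : 0 < b) (hk : 0 < k) (hD : 0 < D)
    (h : D ≤ D') :
    |meanPartialSum a b k D' - meanPartialSum a b k D| ≤ 4 * k / D := by
  have e : meanPartialSum a b k D' - meanPartialSum a b k D =
      ∑ d ∈ Finset.Ioc D D', ∑ e ∈ Finset.Ioc 0 D', meanTerm a b k d e +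
        ∑ d ∈ Finset.Ioc 0 D, ∑ e ∈ Finset.Ioc D D', meanTerm a b k d e := by
    unfold meanPartialSum
    rw [← Finset.sum_Ioc_consecutive _ (Nat.zero_le D) h, add_comm, add_sub_assoc,
      ← Finset.sum_sub_distrib]
    congr 1
    refine Finset.sum_congr rfl fun d _ => ?_
    rw [← Finset.sum_Ioc_consecutive _ (Nat.zero_le D) h]
    ring
  rw [e]
  have h1 := abs_sum_meanTerm_le a hb hk D D' 0 D'
  have h2 := abs_sum_meanTerm_le a hb hk 0 D D D'
  have s1 := sum_Ioc_inv_sq_le hD h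
  have s2 := sum_Ioc_zero_inv_sq_le D'
  have s3 := sum_Ioc_zero_inv_sq_le D
  have n1 : 0 ≤ ∑ d ∈ Finset.Ioc D D', ((d : ℝ) ^ 2)⁻¹ := Finset.sum_nonneg fun _ _ => by positivity
  have n2 : 0 ≤ ∑ d ∈ Finset.Ioc 0 D', ((d : ℝ) ^ 2)⁻¹ := Finset.sum_nonneg fun _ _ => by positivity
  have n3 : 0 ≤ ∑ d ∈ Finset.Ioc 0 D, ((d : ℝ) ^ 2)⁻¹ := Finset.sum_nonneg fun _ _ => by positivity
  refine (abs_add_le _ _).trans ?_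
  calc _ ≤ (k : ℝ) * (1 / D * 2) + k * (2 * (1 / D)) := by
        refine add_le_add (h1.trans ?_) (h2.trans ?_) <;> gcongr
    _ = _ := by ring

/-- The sum of `φ(n) φ(n + k) / (n (n + k))` over `n ≤ N`, `n ≡ a [MOD b]`. -/
noncomputable def totientRatioSum (a b k N : ℕ) : ℝ :=
  ∑ n ∈ (Finset.Icc 1 N).filter (fun n => n ≡ a [MOD b]), totientRatioProd k n

lemma totientRatioSum_eq (a b k N : ℕ) :
    totientRatioSum a b k N = ∑ d ∈ Finset.Ioc 0 (N + k), ∑ e ∈ Finset.Ioc 0 (N + k),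
      ((ArithmeticFunction.moebius d : ℝ) / d * ((ArithmeticFunction.moebius e : ℝ) / e)) *
        ((((Finset.Icc 1 N).filter (fun n => n ≡ a [MOD b])).filter
          (fun n => d ∣ n ∧ e ∣ n + k)).card : ℝ) := by
  unfold totientRatioSum
  have h : ∀ n ∈ (Finset.Icc 1 N).filter (fun n => n ≡ a [MOD b]), totientRatioProd k n =
      ∑ d ∈ Finset.Ioc 0 (N + k), ∑ e ∈ Finset.Ioc 0 (N + k),
        ((ArithmeticFunction.moebius d : ℝ) / d * ((ArithmeticFunction.moebius e : ℝ) / e)) *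
          (if d ∣ n ∧ e ∣ n + k then 1 else 0) := by
    intro n hn
    have hn' := Finset.mem_Icc.1 (Finset.mem_filter.1 hn).1
    unfold totientRatioProd
    rw [totient_div_eq_sum_moebius (n := n) (D := N + k) (by omega) (by omega),
      totient_div_eq_sum_moebius (n := n + k) (D := N + k) (by omega) (by omega),
      Finset.sum_mul_sum]
    refine Finset.sum_congr rfl fun d _ => Finset.sum_congr rfl fun e _ => ?_
    by_cases h1 : d ∣ n <;> by_cases h2 : e ∣ n + k <;> simp [h1, h2]
  rw [Finset.sum_congr rfl h, Finset.sum_comm]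
  refine Finset.sum_congr rfl fun d _ => ?_
  rw [Finset.sum_comm]
  refine Finset.sum_congr rfl fun e _ => ?_
  rw [← Finset.mul_sum, Finset.sum_boole]

lemma sum_Ioc_one_div_le (D : ℕ) : ∑ d ∈ Finset.Ioc 0 D, 1 / (d : ℝ) ≤ 1 + Real.log D := by
  have h := harmonic_le_one_add_log D
  rw [harmonic_eq_sum_Icc] at h
  push_cast at h
  have : Finset.Ioc 0 D = Finset.Icc 1 D := by ext; simp; omega
  rw [this]
  simpa using h

lemma abs_totientRatioSum_sub_le (a k N : ℕ) {b : ℕ} (hb : 0 < b) :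
    |totientRatioSum a b k N - N * meanPartialSum a b k (N + k)| ≤
      (1 + Real.log (N + k : ℕ)) ^ 2 := by
  have hH := sum_Ioc_one_div_le (N + k)
  have hH0 : 0 ≤ ∑ d ∈ Finset.Ioc 0 (N + k), 1 / (d : ℝ) := Finset.sum_nonneg fun _ _ => by positivity
  refine le_trans ?_ (pow_le_pow_left₀ hH0 hH 2)
  rw [totientRatioSum_eq, meanPartialSum, Finset.mul_sum, ← Finset.sum_sub_distrib, sq,
    Finset.sum_mul_sum]
  refine (Finset.abs_sum_le_sum_abs _ _).trans (Finset.sum_le_sum fun d hd => ?_)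
  rw [Finset.mul_sum, ← Finset.sum_sub_distrib]
  refine (Finset.abs_sum_le_sum_abs _ _).trans (Finset.sum_le_sum fun e he => ?_)
  have hc := abs_card_sub_congruenceDensity_le a k N hb (Finset.mem_Ioc.1 hd).1
    (Finset.mem_Ioc.1 he).1
  unfold meanTerm
  rw [mul_left_comm, ← mul_sub, abs_mul, abs_mul]
  calc _ ≤ 1 / (d : ℝ) * (1 / e) * 1 := by
        gcongr
        · exact abs_moebius_div_le d
        · exact abs_moebius_div_le e
    _ = _ := by ring

lemma log_add_le (k : ℕ) {N : ℕ} (hN : 1 ≤ N) :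
    1 + Real.log (N + k : ℕ) ≤ (1 + Real.log (1 + k : ℕ)) * (1 + Real.log N) := by
  have h1 : Real.log (N + k : ℕ) ≤ Real.log ((1 + k : ℕ) * (N : ℝ)) := by
    apply Real.log_le_log
    · exact_mod_cast (by omega)
    · exact_mod_cast (by nlinarith)
  have hN0 : (N : ℝ) ≠ 0 := by exact_mod_cast (by omega)
  rw [Real.log_mul (by positivity) hN0] at h1
  have h2 := Real.log_natCast_nonneg N
  have h3 := Real.log_natCast_nonneg (1 + k)
  nlinarith

lemma tendsto_one_add_log_sq_div : Tendsto (fun N : ℕ => (1 + Real.log N) ^ 2 / (N : ℝ)) atTop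
    (𝓝 0) := by
  have h1 := (isLittleO_log_rpow_rpow_atTop 2 one_pos).tendsto_div_nhds_zero
  have h2 := (isLittleO_log_rpow_rpow_atTop 1 one_pos).tendsto_div_nhds_zero
  have h3 : Tendsto (fun x : ℝ => 1 / x) atTop (𝓝 0) := by
    simpa using tendsto_inv_atTop_zero (𝕜 := ℝ)
  have h := (h3.add ((h2.const_mul 2).add h1)).comp tendsto_natCast_atTop_atTop
  simp only [mul_zero, add_zero] at h
  refine h.congr fun N => ?_
  simp [Function.comp]
  ring

lemma tendsto_meanPartialSum (a k : ℕ) {b : ℕ} (hb : 0 < b) (hbk : b ∣ k) :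
    Tendsto (meanPartialSum a b k) atTop (𝓝 (mirskyConst a b k)) := by
  rw [← tendsto_add_atTop_iff_nat k]
  have h1 := tendsto_mean_totientRatioProd a b k hb hbk
  have h2 : Tendsto (fun N : ℕ => totientRatioSum a b k N / N - meanPartialSum a b k (N + k)) atTop
      (𝓝 0) := by
    have h3 := tendsto_one_add_log_sq_div.const_mul ((1 + Real.log (1 + k : ℕ)) ^ 2)
    rw [mul_zero] at h3
    refine squeeze_zero_norm' ?_ h3
    filter_upwards [eventually_ge_atTop 1] with N hN
    have hN0 : (0 : ℝ) < N := by exact_mod_cast hN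
    have e : totientRatioSum a b k N / N - meanPartialSum a b k (N + k) =
        (totientRatioSum a b k N - N * meanPartialSum a b k (N + k)) / N := by field_simp
    rw [e, Real.norm_eq_abs, abs_div, abs_of_pos hN0, ← mul_div_assoc, ← mul_pow]
    gcongr
    refine (abs_totientRatioSum_sub_le a k N hb).trans ?_
    have := Real.log_natCast_nonneg (N + k)
    gcongr
    exact log_add_le k hN
  have h := h1.sub h2
  rw [sub_zero] at h
  refine h.congr fun N => ?_
  simp [totientRatioSum]

/-- The mean value of `φ(n) φ(n + k) / (n (n + k))`, with a logarithmic error term. -/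
theorem exists_abs_totientRatioSum_sub_le (a k : ℕ) {b : ℕ} (hb : 0 < b) (hbk : b ∣ k)
    (hk : 0 < k) :
    ∃ K : ℝ, 0 ≤ K ∧ ∀ N : ℕ, 1 ≤ N →
      |totientRatioSum a b k N - mirskyConst a b k * N| ≤ K * (1 + Real.log N) ^ 2 := by
  refine ⟨(1 + Real.log (1 + k : ℕ)) ^ 2 + 4 * k, by positivity, fun N hN => ?_⟩
  have h1 := abs_totientRatioSum_sub_le a k N hb
  have h2 : |mirskyConst a b k - meanPartialSum a b k (N + k)| ≤ 4 * k / (N + k : ℕ) := by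
    have ht := ((tendsto_meanPartialSum a k hb hbk).sub_const (meanPartialSum a b k (N + k))).abs
    refine le_of_tendsto ht ?_
    filter_upwards [eventually_ge_atTop (N + k)] with D hD
    exact abs_meanPartialSum_sub_le a hb hk (by omega) hD
  have hN0 : (0 : ℝ) < N := by exact_mod_cast hN
  have h3 : |N * (mirskyConst a b k - meanPartialSum a b k (N + k))| ≤ 4 * k := by
    rw [abs_mul, abs_of_pos hN0]
    calc (N : ℝ) * _ ≤ N * (4 * k / (N + k : ℕ)) := by gcongr
      _ ≤ N * (4 * k / N) := by
          gcongr
          omega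
      _ = _ := by field_simp
  have hl := Real.log_natCast_nonneg N
  have h4 : (1 + Real.log (N + k : ℕ)) ^ 2 ≤
      (1 + Real.log (1 + k : ℕ)) ^ 2 * (1 + Real.log N) ^ 2 := by
    rw [← mul_pow]
    have := Real.log_natCast_nonneg (N + k)
    gcongr
    exact log_add_le k hN
  have h5 : 4 * (k : ℝ) ≤ 4 * k * (1 + Real.log N) ^ 2 := by
    refine le_mul_of_one_le_right (by positivity) ?_
    nlinarith
  have e : totientRatioSum a b k N - mirskyConst a b k * N =
      (totientRatioSum a b k N - N * meanPartialSum a b k (N + k)) -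
        N * (mirskyConst a b k - meanPartialSum a b k (N + k)) := by ring
  rw [e]
  refine (abs_sub _ _).trans ?_
  linarith

lemma mirskyConst_nonneg (a k : ℕ) {b : ℕ} (hb : 0 < b) (hbk : b ∣ k) :
    0 ≤ mirskyConst a b k := by
  refine ge_of_tendsto' (tendsto_mean_totientRatioProd a b k hb hbk) fun N => ?_
  refine div_nonneg (Finset.sum_nonneg fun n _ => ?_) (Nat.cast_nonneg _)
  unfold totientRatioProd
  positivity

/-! ### Partial summation and comparison with an integral -/

/-- Partial summation against coefficients of mean value `c`. -/
lemma norm_sum_mul_sub_le (t : ℕ → ℝ) (G : ℕ → ℂ) (c E L H : ℝ) {M : ℕ} (hM : 1 ≤ M)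
    (hE : ∀ m, 1 ≤ m → m ≤ M → |∑ n ∈ Finset.Icc 1 m, t n - c * m| ≤ E)
    (hL : ∀ m, 1 ≤ m → m < M → ‖G (m + 1) - G m‖ ≤ L) (hH : ‖G M‖ ≤ H) (hL0 : 0 ≤ L) :
    ‖∑ n ∈ Finset.Icc 1 M, (t n : ℂ) * G n - c * ∑ n ∈ Finset.Icc 1 M, G n‖ ≤
      E * (H + M * L) := by
  have key : ∀ m, 1 ≤ m →
      ∑ n ∈ Finset.Icc 1 m, (t n : ℂ) * G n - c * ∑ n ∈ Finset.Icc 1 m, G n =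
        ((∑ n ∈ Finset.Icc 1 m, t n - c * m : ℝ) : ℂ) * G m -
          ∑ j ∈ Finset.Ico 1 m, ((∑ n ∈ Finset.Icc 1 j, t n - c * j : ℝ) : ℂ) *
            (G (j + 1) - G j) := by
    intro m hm
    induction m, hm using Nat.le_induction with
    | base => simp; ring
    | succ m hm ih =>
      rw [Finset.sum_Icc_succ_top (by omega), Finset.sum_Icc_succ_top (by omega),
        Finset.sum_Icc_succ_top (by omega), Finset.sum_Ico_succ_top hm]
      have e : ∑ n ∈ Finset.Icc 1 m, (t n : ℂ) * G n =
          c * ∑ n ∈ Finset.Icc 1 m, G n + (((∑ n ∈ Finset.Icc 1 m, t n - c * m : ℝ) : ℂ) * G m -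
          ∑ j ∈ Finset.Ico 1 m, ((∑ n ∈ Finset.Icc 1 j, t n - c * j : ℝ) : ℂ) *
            (G (j + 1) - G j)) := by rw [← ih]; ring
      rw [e]
      push_cast
      ring
  have hE0 : 0 ≤ E := (abs_nonneg _).trans (hE M hM le_rfl)
  rw [key M hM]
  refine (norm_sub_le _ _).trans ?_
  rw [mul_add]
  refine add_le_add ?_ ?_
  · rw [norm_mul, Complex.norm_real]
    exact mul_le_mul (hE M hM le_rfl) hH (norm_nonneg _) hE0
  · calc _ ≤ ∑ j ∈ Finset.Ico 1 M, E * L := by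
          refine norm_sum_le_of_le _ fun j hj => ?_
          obtain ⟨h1, h2⟩ := Finset.mem_Ico.1 hj
          rw [norm_mul, Complex.norm_real]
          exact mul_le_mul (hE j h1 h2.le) (hL j h1 h2) (norm_nonneg _) hE0
      _ = ((M - 1 : ℕ) : ℝ) * (E * L) := by simp
      _ ≤ M * (E * L) := by
          gcongr
          omega
      _ = _ := by ring

/-- Comparison of the sum and the integral of a Lipschitz function. -/
lemma norm_sum_sub_integral_le (G : ℝ → ℂ) (L H : ℝ) {M : ℕ} (hM : 1 ≤ M)
    (hc : ContinuousOn G (Set.Icc 1 M))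
    (hL : ∀ x ∈ Set.Icc (1 : ℝ) M, ∀ y ∈ Set.Icc (1 : ℝ) M, ‖G x - G y‖ ≤ L * |x - y|)
    (hH : ‖G 1‖ ≤ H) (hL0 : 0 ≤ L) :
    ‖∑ n ∈ Finset.Icc 1 M, G n - ∫ x in (1 : ℝ)..M, G x‖ ≤ H + M * L := by
  have key : ∀ m : ℕ, 1 ≤ m → m ≤ M →
      ‖∑ n ∈ Finset.Icc 1 m, G n - ∫ x in (1 : ℝ)..m, G x‖ ≤ H + m * L := by
    intro m hm
    induction m, hm using Nat.le_induction with
    | base => intro _; simp; linarith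
    | succ m hm ih =>
      intro hmM
      have hm1 : (1 : ℝ) ≤ m := by exact_mod_cast hm
      have hmM' : (m : ℝ) + 1 ≤ M := by exact_mod_cast hmM
      have i1 : IntervalIntegrable G volume 1 m := by
        apply ContinuousOn.intervalIntegrable
        rw [Set.uIcc_of_le hm1]
        exact hc.mono (Set.Icc_subset_Icc le_rfl (by linarith))
      have i2 : IntervalIntegrable G volume m (m + 1) := by
        apply ContinuousOn.intervalIntegrable
        rw [Set.uIcc_of_le (by linarith)]
        exact hc.mono (Set.Icc_subset_Icc hm1 hmM')
      have step : ‖G (m + 1) - ∫ x in (m : ℝ)..(m + 1), G x‖ ≤ L := by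
        have e : G (m + 1) - ∫ x in (m : ℝ)..(m + 1), G x =
            ∫ x in (m : ℝ)..(m + 1), (G (m + 1) - G x) := by
          rw [intervalIntegral.integral_sub (by simp) i2]
          simp
        rw [e]
        have := intervalIntegral.norm_integral_le_of_norm_le_const (a := (m : ℝ)) (b := m + 1)
          (C := L) (f := fun x => G (m + 1) - G x) (fun x hx => ?_)
        · simpa using this
        · rw [Set.uIoc_of_le (by linarith)] at hx
          refine (hL _ ⟨by linarith, hmM'⟩ _ ⟨by linarith [hx.1], by linarith [hx.2]⟩).trans ?_
          have : |(m : ℝ) + 1 - x| ≤ 1 := by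
            rw [abs_le]; constructor <;> linarith [hx.1, hx.2]
          nlinarith
      rw [Finset.sum_Icc_succ_top (by omega)]
      push_cast
      rw [← intervalIntegral.integral_add_adjacent_intervals i1 i2, add_sub_add_comm]
      refine (norm_add_le _ _).trans ?_
      have := ih (by omega)
      linarith
  exact key M hM le_rfl

lemma norm_sub_le_of_norm_deriv_le {f : ℝ → ℂ} {F' : ℝ} (hf : ContDiff ℝ 1 f)
    (hF' : ∀ x, ‖deriv f x‖ ≤ F') (x y : ℝ) : ‖f x - f y‖ ≤ F' * |x - y| :=
  Convex.norm_image_sub_le_of_norm_deriv_le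
    (fun z _ => (hf.differentiable one_ne_zero) z) (fun z _ => hF' z) convex_univ
    (Set.mem_univ y) (Set.mem_univ x)

lemma norm_sq_mul_comp_div_sub_le {f : ℝ → ℂ} {F F' B N : ℝ} (hf : ContDiff ℝ 1 f)
    (hF : ∀ x, ‖f x‖ ≤ F) (hF' : ∀ x, ‖deriv f x‖ ≤ F') (hB : 0 ≤ B) :
    ∀ x ∈ Set.Icc (1 : ℝ) N, ∀ y ∈ Set.Icc (1 : ℝ) N,
      ‖(x : ℂ) ^ 2 * f (B / x) - (y : ℂ) ^ 2 * f (B / y)‖ ≤ (2 * N * F + B * F') * |x - y| := by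
  have hF0 : 0 ≤ F := (norm_nonneg _).trans (hF 0)
  have hF0' : 0 ≤ F' := (norm_nonneg _).trans (hF' 0)
  have main : ∀ x ∈ Set.Icc (1 : ℝ) N, ∀ y ∈ Set.Icc (1 : ℝ) N, y ≤ x →
      ‖(x : ℂ) ^ 2 * f (B / x) - (y : ℂ) ^ 2 * f (B / y)‖ ≤ (2 * N * F + B * F') * |x - y| := by
    intro x hx y hy hyx
    have hx0 : 0 < x := by linarith [hx.1]
    have hy0 : 0 < y := by linarith [hy.1]
    have e : (x : ℂ) ^ 2 * f (B / x) - (y : ℂ) ^ 2 * f (B / y) =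
        ((x ^ 2 - y ^ 2 : ℝ) : ℂ) * f (B / x) + ((y ^ 2 : ℝ) : ℂ) * (f (B / x) - f (B / y)) := by
      push_cast; ring
    rw [e, add_mul]
    refine (norm_add_le _ _).trans (add_le_add ?_ ?_)
    · rw [norm_mul, Complex.norm_real, Real.norm_eq_abs,
        show x ^ 2 - y ^ 2 = (x + y) * (x - y) by ring, abs_mul]
      calc |x + y| * |x - y| * ‖f (B / x)‖ ≤ (2 * N) * |x - y| * F := by
            have h1 : |x + y| ≤ 2 * N := by
              rw [abs_of_pos (by linarith)]; linarith [hx.2, hy.2]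
            have h2 := hF (B / x)
            have h3 : 0 ≤ 2 * N := (abs_nonneg _).trans h1
            gcongr
        _ = _ := by ring
    · rw [norm_mul, Complex.norm_real, Real.norm_eq_abs, abs_of_nonneg (sq_nonneg y)]
      have e2 : B / x - B / y = -(B * (x - y) / (x * y)) := by field_simp; ring
      calc y ^ 2 * ‖f (B / x) - f (B / y)‖ ≤ y ^ 2 * (F' * |B / x - B / y|) := by
            gcongr; exact norm_sub_le_of_norm_deriv_le hf hF' _ _
        _ = (y / x) * (B * F' * |x - y|) := by
            rw [e2, abs_neg, abs_div, abs_mul, abs_of_nonneg hB, abs_of_pos (mul_pos hx0 hy0)]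
            field_simp
        _ ≤ 1 * (B * F' * |x - y|) := by
            gcongr
            exact (div_le_one hx0).2 hyx
        _ = _ := one_mul _
  intro x hx y hy
  rcases le_total y x with h | h
  · exact main x hx y hy h
  · rw [norm_sub_rev, abs_sub_comm]
    exact main y hy x hx h

lemma integral_sq_mul_comp_div {f : ℝ → ℂ} (hf : Continuous f) {B N : ℝ} (hB : 0 < B)
    (hN : 1 ≤ N) :
    ∫ x in (1 : ℝ)..N, (x : ℂ) ^ 2 * f (B / x) =
      (B : ℂ) ^ 3 * ∫ s in (B / N)..B, f s / (s : ℂ) ^ 4 := by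
  have hpos : ∀ x ∈ Set.Icc 1 N, 0 < x := fun x hx => by linarith [hx.1]
  have h := intervalIntegral.integral_deriv_smul_comp'' (a := 1) (b := N)
    (f := fun x => B / x) (f' := fun x => -B / x ^ 2)
    (g := fun s => -((B : ℂ) ^ 3 * (f s / (s : ℂ) ^ 4))) ?_ ?_ ?_ ?_
  · rw [div_one] at h
    rw [intervalIntegral.integral_neg, ← intervalIntegral.integral_symm,
      intervalIntegral.integral_const_mul] at h
    rw [← h]
    refine intervalIntegral.integral_congr fun x hx => ?_
    rw [Set.uIcc_of_le hN] at hx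
    have hx0 : (x : ℂ) ≠ 0 := by exact_mod_cast (hpos x hx).ne'
    have hB0 : (B : ℂ) ≠ 0 := by exact_mod_cast hB.ne'
    simp only [Function.comp, Complex.real_smul]
    push_cast
    field_simp
  · rw [Set.uIcc_of_le hN]
    exact continuousOn_const.div continuousOn_id fun x hx => (hpos x hx).ne'
  · intro x hx
    rw [min_eq_left hN, max_eq_right hN] at hx
    have hx0 : x ≠ 0 := (hpos x ⟨hx.1.le, hx.2.le⟩).ne'
    have := ((hasDerivAt_inv hx0).const_mul B).hasDerivWithinAt (s := Set.Ioi x)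
    simpa [div_eq_mul_inv] using this
  · rw [Set.uIcc_of_le hN]
    exact continuousOn_const.div (continuousOn_id.pow 2) fun x hx => by
      have := hpos x hx; simp; linarith
  · rw [Set.uIcc_of_le hN]
    refine ContinuousOn.neg (continuousOn_const.mul (hf.continuousOn.div
      (Complex.continuous_ofReal.continuousOn.pow 4) ?_))
    rintro s ⟨x, hx, rfl⟩
    have : B / x ≠ 0 := (div_pos hB (hpos x hx)).ne'
    exact pow_ne_zero 4 (by exact_mod_cast this)

/-- `log (1 + k / n)` is `k / n` up to `(k / n) ^ 2`. -/
lemma abs_log_add_sub_log_sub_le {k n : ℝ} (hk : 0 ≤ k) (hn : 0 < n) :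
    |Real.log (n + k) - Real.log n - k / n| ≤ (k / n) ^ 2 := by
  have hu : 0 ≤ k / n := by positivity
  have e : Real.log (n + k) - Real.log n = Real.log (1 + k / n) := by
    rw [← Real.log_div (by positivity) (by positivity)]
    congr 1
    field_simp
  rw [e]
  set u := k / n
  have h1 : Real.log (1 + u) ≤ u := by
    have := Real.log_le_sub_one_of_pos (show 0 < 1 + u by linarith)
    linarith
  have h2 : 1 - (1 + u)⁻¹ ≤ Real.log (1 + u) := Real.one_sub_inv_le_log_of_pos (by linarith)
  have h3 : 1 - (1 + u)⁻¹ = u / (1 + u) := by field_simp; ring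
  have h4 : u - u ^ 2 ≤ u / (1 + u) := by
    rw [le_div_iff₀ (by linarith)]
    have : 0 ≤ u ^ 3 := by positivity
    nlinarith
  rw [abs_le]
  constructor <;> nlinarith [sq_nonneg u]

/-! ### Pairs with a given difference -/

/-- The contribution to the sum of `φ(m) φ(n) f(N (ln m - ln n))` over `I_N` of the pairs with
`m - n = k`. -/
noncomputable def corrSum (a b k N : ℕ) (f : ℝ → ℂ) : ℂ :=
  ∑ n ∈ ((Finset.Icc 1 N).filter (fun n => n ≡ a [MOD b])).filter (fun n => n + k ≤ N),
    ((Nat.totient n : ℂ) * (Nat.totient (n + k) : ℂ)) *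
      f ((N : ℝ) * (Real.log (n + k : ℕ) - Real.log n))

lemma totientRatioProd_mem (k n : ℕ) :
    0 ≤ totientRatioProd k n ∧ totientRatioProd k n ≤ 1 := by
  have h : ∀ m : ℕ, (Nat.totient m / m : ℝ) ≤ 1 := fun m =>
    div_le_one_of_le₀ (by exact_mod_cast Nat.totient_le m) (Nat.cast_nonneg _)
  unfold totientRatioProd
  refine ⟨by positivity, mul_le_one₀ (h n) (by positivity) (h (n + k))⟩

/-- Replacing `(n + k) n f(N log (1 + k / n))` by `n ^ 2 f(N k / n)` in the sum over the pairs with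
difference `k`. -/
lemma norm_corrSum_sub_le {a b k N : ℕ} {F F' : ℝ} {f : ℝ → ℂ} (hf : ContDiff ℝ 1 f)
    (hF : ∀ x, ‖f x‖ ≤ F) (hF' : ∀ x, ‖deriv f x‖ ≤ F') :
    ‖corrSum a b k N f - ∑ n ∈ ((Finset.Icc 1 N).filter (fun n => n ≡ a [MOD b])).filter
        (fun n => n + k ≤ N),
          (totientRatioProd k n : ℂ) * (((n : ℝ) : ℂ) ^ 2 * f ((N * k : ℝ) / (n : ℝ)))‖ ≤
      N * (N * k * F + N * k ^ 2 * F') := by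
  have hF0 : 0 ≤ F := (norm_nonneg _).trans (hF 0)
  have hF0' : 0 ≤ F' := (norm_nonneg _).trans (hF' 0)
  unfold corrSum
  rw [← Finset.sum_sub_distrib]
  calc _ ≤ ∑ n ∈ ((Finset.Icc 1 N).filter (fun n => n ≡ a [MOD b])).filter
        (fun n => n + k ≤ N), (N * k * F + N * k ^ 2 * F') := by
        refine norm_sum_le_of_le _ fun n hn => ?_
        have hn' := Finset.mem_Icc.1 (Finset.mem_filter.1 (Finset.mem_filter.1 hn).1).1
        have hn0 : (0 : ℝ) < n := by exact_mod_cast hn'.1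
        have hnN : (n : ℝ) ≤ N := by exact_mod_cast hn'.2
        have hnk : ((n + k : ℕ) : ℝ) ≠ 0 := by
          have : 0 < n + k := by omega
          positivity
        obtain ⟨r0, r1⟩ := totientRatioProd_mem k n
        have et : (Nat.totient n : ℂ) * (Nat.totient (n + k) : ℂ) =
            (totientRatioProd k n : ℂ) * ((n * (n + k) : ℝ) : ℂ) := by
          have : (Nat.totient n : ℝ) * (Nat.totient (n + k) : ℝ) =
              totientRatioProd k n * (n * (n + k)) := by
            unfold totientRatioProd
            push_cast at hnk ⊢
            field_simp
          exact_mod_cast this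
        rw [et]
        set s := (N : ℝ) * (Real.log (n + k : ℕ) - Real.log n)
        set s' := (N * k : ℝ) / (n : ℝ)
        have e : (totientRatioProd k n : ℂ) * ((n * (n + k) : ℝ) : ℂ) * f s -
            (totientRatioProd k n : ℂ) * (((n : ℝ) : ℂ) ^ 2 * f s') =
            (totientRatioProd k n : ℂ) *
              (((n * k : ℝ) : ℂ) * f s + ((n ^ 2 : ℝ) : ℂ) * (f s - f s')) := by
          push_cast; ring
        rw [e, norm_mul, Complex.norm_real, Real.norm_of_nonneg r0]
        have hss : |s - s'| ≤ N * (k / n) ^ 2 := by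
          have hlog := abs_log_add_sub_log_sub_le (k := k) (n := n) (Nat.cast_nonneg k) hn0
          have e2 : s - s' = N * (Real.log (n + k) - Real.log n - k / n) := by
            simp only [s, s']; push_cast; ring
          rw [e2, abs_mul, Nat.abs_cast]
          gcongr
        refine (mul_le_of_le_one_left (norm_nonneg _) r1).trans ((norm_add_le _ _).trans ?_)
        refine add_le_add ?_ ?_
        · rw [norm_mul, Complex.norm_real, Real.norm_of_nonneg (by positivity)]
          have := hF s
          gcongr
        · rw [norm_mul, Complex.norm_real, Real.norm_of_nonneg (by positivity)]
          calc (n : ℝ) ^ 2 * ‖f s - f s'‖ ≤ (n : ℝ) ^ 2 * (F' * (N * (k / n) ^ 2)) := by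
                gcongr
                exact (norm_sub_le_of_norm_deriv_le hf hF' s s').trans (by gcongr)
            _ = _ := by field_simp
    _ ≤ _ := by
        rw [Finset.sum_const, nsmul_eq_mul]
        gcongr
        refine (Finset.card_le_card ((Finset.filter_subset _ _).trans
          (Finset.filter_subset _ _))).trans ?_
        simp

/-- The pairs with difference `k` contribute `c_k k ^ 3 ∫ f(s) / s ^ 4 ds` over `s ≥ k`. The
quantity `E` is the error in the mean value of `φ(n) φ(n + k) / (n (n + k))`. -/
lemma norm_corrSum_sub_integral_le {a b k N : ℕ} {c E F F' : ℝ} {f : ℝ → ℂ} (hk : 1 ≤ k)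
    (hN : 1 ≤ N)
    (hE : ∀ m : ℕ, 1 ≤ m → m ≤ N → |totientRatioSum a b k m - c * m| ≤ E)
    (hf : ContDiff ℝ 1 f) (hF : ∀ x, ‖f x‖ ≤ F) (hF' : ∀ x, ‖deriv f x‖ ≤ F') :
    ‖corrSum a b k N f - (N : ℂ) ^ 3 *
        ((c : ℂ) * (k : ℂ) ^ 3 * ∫ s in (k : ℝ)..(N * k : ℝ), f s / (s : ℂ) ^ 4)‖ ≤
      N ^ 2 * (3 * k ^ 2 * (1 + E + |c|) * (F + F')) := by
  classical
  have hF0 : 0 ≤ F := (norm_nonneg _).trans (hF 0)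
  have hF0' : 0 ≤ F' := (norm_nonneg _).trans (hF' 0)
  have hE0 : 0 ≤ E := (abs_nonneg _).trans (hE 1 le_rfl hN)
  have hN1 : (1 : ℝ) ≤ N := by exact_mod_cast hN
  have hk1 : (1 : ℝ) ≤ k := by exact_mod_cast hk
  let G : ℝ → ℂ := fun x => (x : ℂ) ^ 2 * f ((N * k : ℝ) / x)
  let U := (Finset.Icc 1 N).filter (fun n => n ≡ a [MOD b])
  let L : ℝ := 2 * N * F + N * k * F'
  have hL0 : 0 ≤ L := by positivity
  have hGF : ∀ n : ℕ, n ≤ N → ‖G n‖ ≤ N ^ 2 * F := by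
    intro n hn
    have : (n : ℝ) ≤ N := by exact_mod_cast hn
    simp only [G]
    rw [norm_mul, norm_pow, Complex.norm_real, Real.norm_of_nonneg (Nat.cast_nonneg _)]
    have := hF ((N * k : ℝ) / n)
    gcongr
  have hGL : ∀ x ∈ Set.Icc (1 : ℝ) N, ∀ y ∈ Set.Icc (1 : ℝ) N, ‖G x - G y‖ ≤ L * |x - y| :=
    norm_sq_mul_comp_div_sub_le hf hF hF' (by positivity)
  have hGc : ContinuousOn G (Set.Icc 1 N) := by
    refine (Complex.continuous_ofReal.continuousOn.pow 2).mul
      (hf.continuous.comp_continuousOn (continuousOn_const.div continuousOn_id fun x hx => ?_))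
    have := hx.1
    simp; linarith
  -- the pairs with `n ≤ N < n + k` are few
  have h1 : ‖∑ n ∈ U.filter (fun n => n + k ≤ N), (totientRatioProd k n : ℂ) * G n -
      ∑ n ∈ U, (totientRatioProd k n : ℂ) * G n‖ ≤ k * (N ^ 2 * F) := by
    rw [← Finset.sum_filter_add_sum_filter_not U (fun n => n + k ≤ N)
      (fun n => (totientRatioProd k n : ℂ) * G n), sub_add_cancel_left, norm_neg]
    calc _ ≤ ∑ n ∈ U.filter (fun n => ¬ n + k ≤ N), N ^ 2 * F := by
          refine norm_sum_le_of_le _ fun n hn => ?_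
          have hn' := Finset.mem_Icc.1 (Finset.mem_filter.1 (Finset.mem_filter.1 hn).1).1
          obtain ⟨r0, r1⟩ := totientRatioProd_mem k n
          rw [norm_mul, Complex.norm_real, Real.norm_of_nonneg r0]
          exact (mul_le_of_le_one_left (norm_nonneg _) r1).trans (hGF n hn'.2)
      _ ≤ _ := by
          rw [Finset.sum_const, nsmul_eq_mul]
          gcongr
          have hsub : U.filter (fun n => ¬ n + k ≤ N) ⊆ Finset.Ioc (N - k) N := by
            intro n hn
            have hn' := Finset.mem_Icc.1 (Finset.mem_filter.1 (Finset.mem_filter.1 hn).1).1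
            have := (Finset.mem_filter.1 hn).2
            exact Finset.mem_Ioc.2 ⟨by omega, hn'.2⟩
          refine (Finset.card_le_card hsub).trans ?_
          rw [Nat.card_Ioc]
          omega
  have h2 : ‖∑ n ∈ U, (totientRatioProd k n : ℂ) * G n - c * ∑ n ∈ Finset.Icc 1 N, G n‖ ≤
      E * (N ^ 2 * F + N * L) := by
    have := norm_sum_mul_sub_le (fun n => if n ≡ a [MOD b] then totientRatioProd k n else 0)
      (fun n => G n) c E L (N ^ 2 * F) hN ?_ ?_ (hGF N le_rfl) hL0
    · rw [Finset.sum_filter]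
      convert this using 5 with n hn
      split_ifs <;> simp
    · intro m hm hmN
      rw [← Finset.sum_filter]
      exact hE m hm hmN
    · intro m hm hmN
      have hm1 : (1 : ℝ) ≤ m := by exact_mod_cast hm
      have hmN' : (m : ℝ) + 1 ≤ N := by exact_mod_cast hmN
      have := hGL (m + 1) ⟨by linarith, hmN'⟩ m ⟨hm1, by linarith⟩
      simpa using this
  have h3 : ‖∑ n ∈ Finset.Icc 1 N, G n - ∫ x in (1 : ℝ)..N, G x‖ ≤ F + N * L := by
    refine norm_sum_sub_integral_le G L F hN hGc hGL ?_ hL0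
    simpa [G] using hF (N * k)
  have h4 : ∫ x in (1 : ℝ)..N, G x = (N : ℂ) ^ 3 * ((k : ℂ) ^ 3 *
      ∫ s in (k : ℝ)..(N * k : ℝ), f s / (s : ℂ) ^ 4) := by
    have := integral_sq_mul_comp_div hf.continuous (B := N * k) (N := N) (by positivity) hN1
    rw [this]
    have e : (N * k : ℝ) / N = k := by field_simp
    rw [e]
    push_cast
    ring
  have h0 := norm_corrSum_sub_le (a := a) (b := b) (k := k) (N := N) hf hF hF'
  rw [h4] at h3
  set T := ∑ n ∈ Finset.Icc 1 N, G n
  set I := ∫ s in (k : ℝ)..(N * k : ℝ), f s / (s : ℂ) ^ 4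
  have h3' : ‖(c : ℂ) * T - c * ((N : ℂ) ^ 3 * ((k : ℂ) ^ 3 * I))‖ ≤ |c| * (F + N * L) := by
    rw [← mul_sub, norm_mul, Complex.norm_real, Real.norm_eq_abs]
    gcongr
  have e : (N : ℂ) ^ 3 * ((c : ℂ) * (k : ℂ) ^ 3 * I) = c * ((N : ℂ) ^ 3 * ((k : ℂ) ^ 3 * I)) := by
    ring
  rw [e]
  have tri := (norm_sub_le_norm_sub_add_norm_sub _ _ _).trans (add_le_add h0
    ((norm_sub_le_norm_sub_add_norm_sub _ _ _).trans (add_le_add h1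
      ((norm_sub_le_norm_sub_add_norm_sub _ _ _).trans (add_le_add h2 h3')))))
  refine tri.trans ?_
  have n1 : F + N * L ≤ N ^ 2 * (3 * F + k * F') := by
    have : F ≤ N ^ 2 * F := le_mul_of_one_le_left hF0 (by nlinarith)
    simp only [L]
    nlinarith
  have n2 : N ^ 2 * F + N * L = N ^ 2 * (3 * F + k * F') := by simp only [L]; ring
  have n3 : 3 * F + k * F' ≤ 3 * k ^ 2 * (F + F') := by
    have : (k : ℝ) ≤ k ^ 2 := by nlinarith
    nlinarith [mul_nonneg hF0 (show (0 : ℝ) ≤ (k : ℝ) ^ 2 - 1 by nlinarith),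
      mul_nonneg hF0' (show (0 : ℝ) ≤ (k : ℝ) ^ 2 - k by nlinarith)]
  have n4 : k * F + (k ^ 2 * F' + k * F) ≤ 3 * k ^ 2 * (F + F') := by
    nlinarith [mul_nonneg hF0 (show (0 : ℝ) ≤ (k : ℝ) ^ 2 - k by nlinarith),
      mul_nonneg hF0' (show (0 : ℝ) ≤ (k : ℝ) ^ 2 by positivity),
      mul_nonneg hF0 (show (0 : ℝ) ≤ (k : ℝ) ^ 2 by positivity)]
  rw [n2]
  calc N * (N * k * F + N * k ^ 2 * F') + (k * (N ^ 2 * F) + (E * (N ^ 2 * (3 * F + k * F')) +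
        |c| * (F + N * L)))
      ≤ N * (N * k * F + N * k ^ 2 * F') + (k * (N ^ 2 * F) + (E * (N ^ 2 * (3 * F + k * F')) +
        |c| * (N ^ 2 * (3 * F + k * F')))) := by gcongr
    _ = N ^ 2 * ((k * F + (k ^ 2 * F' + k * F)) + (E * (3 * F + k * F') +
        |c| * (3 * F + k * F'))) := by ring
    _ ≤ N ^ 2 * (3 * k ^ 2 * (F + F') + (E * (3 * k ^ 2 * (F + F')) +
        |c| * (3 * k ^ 2 * (F + F')))) := by gcongr
    _ = _ := by ring

/-! ### The pair correlation measure as a sum over differences -/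

/-- The positive differences that contribute to the pair correlation on `[-K, K]`. -/
def differences (b K : ℕ) : Finset ℕ := (Finset.Icc 1 K).filter (fun k => b ∣ k)

lemma mem_differences {b K k : ℕ} : k ∈ differences b K ↔ (1 ≤ k ∧ k ≤ K) ∧ b ∣ k := by
  simp [differences]

lemma mem_indexPairs {a b N m n : ℕ} : (m, n) ∈ indexPairs a b N ↔
    ((1 ≤ m ∧ m ≤ N) ∧ (1 ≤ n ∧ n ≤ N)) ∧ m ≠ n ∧ m ≡ a [MOD b] ∧ n ≡ a [MOD b] := by
  simp [indexPairs]

lemma sum_indexPairs_lt (a b N K : ℕ) (G : ℕ × ℕ → ℂ)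
    (hG : ∀ m n, (m, n) ∈ indexPairs a b N → n + K < m → G (m, n) = 0) :
    ∑ x ∈ (indexPairs a b N).filter (fun x => x.2 < x.1), G x =
      ∑ k ∈ differences b K,
        ∑ n ∈ ((Finset.Icc 1 N).filter (fun n => n ≡ a [MOD b])).filter (fun n => n + k ≤ N),
          G (n + k, n) := by
  have h1 : ∑ x ∈ (indexPairs a b N).filter (fun x => x.2 < x.1), G x =
      ∑ x ∈ ((indexPairs a b N).filter (fun x => x.2 < x.1)).filter (fun x => x.1 ≤ x.2 + K),
        G x := by
    symm
    refine Finset.sum_filter_of_ne fun x hx hne => ?_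
    by_contra hcon
    exact hne (hG x.1 x.2 (Finset.mem_filter.1 hx).1 (by omega))
  rw [h1, Finset.sum_sigma']
  refine Finset.sum_nbij' (fun x => ⟨x.1 - x.2, x.2⟩) (fun y => (y.2 + y.1, y.2)) ?_ ?_ ?_ ?_ ?_
  · rintro ⟨m, n⟩ hx
    simp only [Finset.mem_filter, mem_indexPairs] at hx
    obtain ⟨⟨⟨⟨hm, hn⟩, hne, hma, hna⟩, hlt⟩, hK⟩ := hx
    simp only [Finset.mem_sigma, mem_differences, Finset.mem_filter, Finset.mem_Icc]
    refine ⟨⟨⟨by omega, by omega⟩, ?_⟩, ⟨⟨by omega, by omega⟩, hna⟩, by omega⟩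
    exact (Nat.modEq_iff_dvd' hlt.le).1 (hna.trans hma.symm)
  · rintro ⟨k, n⟩ hy
    simp only [Finset.mem_sigma, mem_differences, Finset.mem_filter, Finset.mem_Icc] at hy
    obtain ⟨⟨⟨hk, hkK⟩, hbk⟩, ⟨⟨hn1, hnN⟩, hna⟩, hnk⟩ := hy
    simp only [Finset.mem_filter, mem_indexPairs]
    refine ⟨⟨⟨⟨⟨by omega, by omega⟩, ⟨by omega, by omega⟩⟩, by omega, ?_, hna⟩, by omega⟩, by omega⟩
    have : n + k ≡ n + 0 [MOD b] := (Nat.ModEq.refl n).add (Nat.modEq_zero_iff_dvd.2 hbk)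
    exact this.trans hna
  · rintro ⟨m, n⟩ hx
    have := (Finset.mem_filter.1 (Finset.mem_filter.1 hx).1).2
    simp only [Prod.mk.injEq, and_true] at this ⊢
    omega
  · rintro ⟨k, n⟩ _
    simp
  · rintro ⟨m, n⟩ hx
    have := (Finset.mem_filter.1 (Finset.mem_filter.1 hx).1).2
    simp only at this ⊢
    congr 2
    omega

lemma sum_indexPairs (a b N K : ℕ) (G : ℕ × ℕ → ℂ)
    (hG : ∀ m n, (m, n) ∈ indexPairs a b N → n + K < m → G (m, n) = 0 ∧ G (n, m) = 0) :
    ∑ x ∈ indexPairs a b N, G x =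
      ∑ k ∈ differences b K,
        ∑ n ∈ ((Finset.Icc 1 N).filter (fun n => n ≡ a [MOD b])).filter (fun n => n + k ≤ N),
          (G (n + k, n) + G (n, n + k)) := by
  have hswap : ∑ x ∈ (indexPairs a b N).filter (fun x => ¬ x.2 < x.1), G x =
      ∑ x ∈ (indexPairs a b N).filter (fun x => x.2 < x.1), G x.swap := by
    refine Finset.sum_nbij' Prod.swap Prod.swap ?_ ?_ ?_ ?_ ?_
    · rintro ⟨m, n⟩ hx
      simp only [Finset.mem_filter, mem_indexPairs, Prod.swap_prod_mk] at hx ⊢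
      exact ⟨⟨⟨hx.1.1.2, hx.1.1.1⟩, hx.1.2.1.symm, hx.1.2.2.2, hx.1.2.2.1⟩, by
        have := hx.1.2.1; omega⟩
    · rintro ⟨m, n⟩ hx
      simp only [Finset.mem_filter, mem_indexPairs, Prod.swap_prod_mk] at hx ⊢
      exact ⟨⟨⟨hx.1.1.2, hx.1.1.1⟩, hx.1.2.1.symm, hx.1.2.2.2, hx.1.2.2.1⟩, by omega⟩
    · intro x _; simp
    · intro x _; simp
    · intro x _; simp
  rw [← Finset.sum_filter_add_sum_filter_not _ (fun x : ℕ × ℕ => x.2 < x.1), hswap,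
    sum_indexPairs_lt a b N K G fun m n h h' => (hG m n h h').1,
    sum_indexPairs_lt a b N K (fun x => G x.swap) fun m n h h' => (hG m n h h').2,
    ← Finset.sum_add_distrib]
  refine Finset.sum_congr rfl fun k _ => ?_
  rw [← Finset.sum_add_distrib]
  rfl

lemma integral_normPairCorrMeasure (a b N : ℕ) (f : ℝ → ℂ) :
    ∫ x, f x ∂(normPairCorrMeasure a b N) = ((N : ℂ) ^ 3)⁻¹ *
      ∑ x ∈ indexPairs a b N, ((Nat.totient x.1 : ℂ) * (Nat.totient x.2 : ℂ)) *
        f ((N : ℝ) * (Real.log x.1 - Real.log x.2)) := by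
  unfold normPairCorrMeasure pairCorrMeasure
  rw [integral_smul_nnreal_measure, integral_finsetSum_measure]
  · simp only [integral_smul_nnreal_measure, integral_dirac, NNReal.smul_def]
    simp [Complex.real_smul]
  · intro x _
    exact (integrable_dirac (by simp)).smul_measure_nnreal

/-- The gap between two distinct points `N log n`, with `n ≤ N`, is at least the difference of the
two integers. -/
lemma sub_le_mul_log_sub_log {N m n : ℕ} (hn : 1 ≤ n) (hnm : n ≤ m) (hm : m ≤ N) :
    ((m : ℝ) - n) ≤ N * (Real.log m - Real.log n) := by
  have hn0 : (0 : ℝ) < n := by exact_mod_cast hn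
  have hnm' : (n : ℝ) ≤ m := by exact_mod_cast hnm
  have hm0 : (0 : ℝ) < m := by linarith
  have hmN : (m : ℝ) ≤ N := by exact_mod_cast hm
  rw [← Real.log_div hm0.ne' hn0.ne']
  have h := Real.one_sub_inv_le_log_of_pos (show (0 : ℝ) < m / n by positivity)
  have e : 1 - ((m : ℝ) / n)⁻¹ = (m - n) / m := by field_simp
  rw [e] at h
  calc (m : ℝ) - n = m * ((m - n) / m) := by field_simp
    _ ≤ N * ((m - n) / m) := by
        gcongr
    _ ≤ _ := by gcongr

lemma integral_normPairCorrMeasure_eq_sum (a b N : ℕ) {A : ℝ} {f : ℝ → ℂ}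
    (hf : Function.support f ⊆ Set.Icc (-A) A) :
    ∫ x, f x ∂(normPairCorrMeasure a b N) = ((N : ℂ) ^ 3)⁻¹ *
      ∑ k ∈ differences b ⌊A⌋₊,
        (corrSum a b k N f + corrSum a b k N (fun s => f (-s))) := by
  rw [integral_normPairCorrMeasure, sum_indexPairs a b N ⌊A⌋₊]
  · congr 1
    refine Finset.sum_congr rfl fun k _ => ?_
    unfold corrSum
    rw [← Finset.sum_add_distrib]
    refine Finset.sum_congr rfl fun n _ => ?_
    simp only
    rw [mul_comm (Nat.totient (n + k) : ℂ), ← mul_neg, neg_sub]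
  · intro m n hmn hlt
    rw [mem_indexPairs] at hmn
    have hA' : A < (m : ℝ) - n := by
      have h1 := Nat.lt_floor_add_one A
      have h2 : (n : ℝ) + ⌊A⌋₊ + 1 ≤ m := by exact_mod_cast hlt
      linarith
    have hgap := sub_le_mul_log_sub_log hmn.1.2.1 (by omega) hmn.1.1.2
    have hz : ∀ s : ℝ, A < |s| → f s = 0 := by
      intro s hs
      by_contra hne
      have := hf (Function.mem_support.2 hne)
      exact absurd (abs_le.2 this) (by linarith)
    have h1 : A < |(N : ℝ) * (Real.log m - Real.log n)| :=
      lt_of_lt_of_le (by linarith) (le_abs_self _)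
    constructor
    · simp only
      rw [hz _ h1, mul_zero]
    · simp only
      rw [hz, mul_zero]
      rw [← neg_sub, mul_neg, abs_neg]
      exact h1

/-! ### The limit density as a sum over differences -/

lemma integrable_indicator_div_pow {f : ℝ → ℂ} (hf : Continuous f) {k B : ℝ} (hk : 0 < k)
    (hkB : k ≤ B) (hB : ∀ s, B < s → f s = 0) :
    Integrable ((Set.Ici k).indicator (fun s => f s / (s : ℂ) ^ 4)) ∧
      ∫ s, (Set.Ici k).indicator (fun s => f s / (s : ℂ) ^ 4) s =
        ∫ s in k..B, f s / (s : ℂ) ^ 4 := by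
  have hc : ContinuousOn (fun s : ℝ => f s / (s : ℂ) ^ 4) (Set.Icc k B) := by
    refine hf.continuousOn.div (Complex.continuous_ofReal.continuousOn.pow 4) fun s hs => ?_
    have : s ≠ 0 := by linarith [hs.1]
    exact pow_ne_zero 4 (by exact_mod_cast this)
  have e : (Set.Ici k).indicator (fun s : ℝ => f s / (s : ℂ) ^ 4) =
      (Set.Icc k B).indicator (fun s : ℝ => f s / (s : ℂ) ^ 4) := by
    ext s
    by_cases h1 : k ≤ s
    · by_cases h2 : s ≤ B
      · rw [Set.indicator_of_mem (by exact h1), Set.indicator_of_mem (by exact ⟨h1, h2⟩)]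
      · rw [Set.indicator_of_mem (by exact h1), Set.indicator_of_notMem (by exact fun h => h2 h.2),
          hB s (by linarith), zero_div]
    · rw [Set.indicator_of_notMem (by exact h1), Set.indicator_of_notMem (by exact fun h => h1 h.1)]
  rw [e]
  constructor
  · exact (integrable_indicator_iff measurableSet_Icc).2 hc.integrableOn_Icc
  · rw [integral_indicator measurableSet_Icc, integral_Icc_eq_integral_Ioc,
      intervalIntegral.integral_of_le hkB]

lemma mul_pairCorrFun_eq_sum (a b : ℕ) {A : ℝ} {f : ℝ → ℂ}
    (hf : Function.support f ⊆ Set.Icc (-A) A) (s : ℝ) :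
    f s * (pairCorrFun a b s : ℂ) = ∑ k ∈ differences b ⌊A⌋₊, ((mirskyConst a b k : ℂ) * (k : ℂ) ^ 3) *
      ((Set.Ici (k : ℝ)).indicator (fun s => f s / (s : ℂ) ^ 4) s +
        (Set.Ici (k : ℝ)).indicator (fun s => f (-s) / (s : ℂ) ^ 4) (-s)) := by
  by_cases hs : f s = 0
  · rw [hs, zero_mul]
    symm
    refine Finset.sum_eq_zero fun k _ => ?_
    simp [Set.indicator_apply, hs]
  have hsA : |s| ≤ A := abs_le.2 (hf hs)
  have hsub : differences b ⌊|s|⌋₊ = (differences b ⌊A⌋₊).filter (fun k : ℕ => (k : ℝ) ≤ |s|) := by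
    ext k
    have h1 : ⌊|s|⌋₊ ≤ ⌊A⌋₊ := Nat.floor_le_floor hsA
    have h2 := Nat.le_floor_iff (abs_nonneg s) (n := k)
    simp only [Finset.mem_filter, mem_differences, ← h2]
    constructor
    · rintro ⟨⟨h3, h4⟩, h5⟩; exact ⟨⟨⟨h3, by omega⟩, h5⟩, h4⟩
    · rintro ⟨⟨⟨h3, _⟩, h5⟩, h4⟩; exact ⟨⟨h3, h4⟩, h5⟩
  unfold pairCorrFun
  change f s * ((1 / s ^ 4 * ∑ k ∈ differences b ⌊|s|⌋₊, mirskyConst a b k * (k : ℝ) ^ 3 : ℝ) : ℂ) = _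
  rw [hsub, Finset.sum_filter]
  push_cast
  rw [← mul_assoc, Finset.mul_sum]
  refine Finset.sum_congr rfl fun k hk => ?_
  have hk1 : (1 : ℝ) ≤ k := by exact_mod_cast (mem_differences.1 hk).1.1
  have h4 : Even 4 := by decide
  simp only [Set.indicator_apply, Set.mem_Ici, neg_neg, Complex.ofReal_neg, h4.neg_pow]
  rcases le_total 0 s with h | h
  · rw [abs_of_nonneg h, if_neg (show ¬ (k : ℝ) ≤ -s by linarith), add_zero]
    split_ifs
    · push_cast; ring
    · simp
  · rw [abs_of_nonpos h, if_neg (show ¬ (k : ℝ) ≤ s by linarith), zero_add]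
    split_ifs
    · push_cast; ring
    · simp

lemma integral_mul_pairCorrFun (a b : ℕ) {A : ℝ} (hA : 0 ≤ A) {f : ℝ → ℂ} (hfc : Continuous f)
    (hf : Function.support f ⊆ Set.Icc (-A) A) (N : ℕ) (hN : A ≤ N) :
    ∫ s : ℝ, f s * (pairCorrFun a b s : ℂ) = ∑ k ∈ differences b ⌊A⌋₊,
      ((mirskyConst a b k : ℂ) * (k : ℂ) ^ 3 * (∫ s in (k : ℝ)..(N * k : ℝ), f s / (s : ℂ) ^ 4) +
      (mirskyConst a b k : ℂ) * (k : ℂ) ^ 3 *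
        ∫ s in (k : ℝ)..(N * k : ℝ), f (-s) / (s : ℂ) ^ 4) := by
  have hz : ∀ s : ℝ, A < |s| → f s = 0 := by
    intro s hs
    by_contra hne
    have := hf (Function.mem_support.2 hne)
    exact absurd (abs_le.2 this) (by linarith)
  have key : ∀ k ∈ differences b ⌊A⌋₊, (1 : ℝ) ≤ k ∧ (k : ℝ) ≤ N * k ∧ A ≤ N * k := by
    intro k hk
    obtain ⟨⟨h1, h2⟩, _⟩ := mem_differences.1 hk
    have hk1 : (1 : ℝ) ≤ k := by exact_mod_cast h1
    have hkA : (k : ℝ) ≤ A := (Nat.le_floor_iff hA).1 h2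
    exact ⟨hk1, by nlinarith, by nlinarith⟩
  have i1 : ∀ k ∈ differences b ⌊A⌋₊, _ := fun k hk =>
    integrable_indicator_div_pow hfc (k := k) (B := N * k) (by linarith [(key k hk).1])
      (key k hk).2.1 fun s hs => hz s
        (by rw [lt_abs]; left; linarith [(key k hk).2.2])
  have i2 : ∀ k ∈ differences b ⌊A⌋₊, _ := fun k hk =>
    integrable_indicator_div_pow (f := fun s => f (-s)) (by fun_prop) (k := k) (B := N * k)
      (by linarith [(key k hk).1]) (key k hk).2.1 fun s hs => hz (-s)
        (by rw [lt_abs]; right; linarith [(key k hk).2.2])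
  simp only [mul_pairCorrFun_eq_sum a b hf]
  rw [integral_finsetSum]
  · refine Finset.sum_congr rfl fun k hk => ?_
    rw [integral_const_mul, integral_add (i1 k hk).1 (i2 k hk).1.comp_neg, (i1 k hk).2, mul_add]
    congr 2
    rw [← (i2 k hk).2]
    exact integral_neg_eq_self
      ((Set.Ici (k : ℝ)).indicator (fun s => f (-s) / (s : ℂ) ^ 4)) volume
  · intro k hk
    exact ((i1 k hk).1.add (i2 k hk).1.comp_neg).const_mul _

/-! ### The effective convergence -/

/-- Quantitative convergence, with a constant depending on the support of the test function. -/
theorem exists_norm_integral_sub_le (a : ℕ) {b : ℕ} (hb : 0 < b) {A : ℝ} (hA : 0 ≤ A) :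
    ∃ K : ℝ, 0 ≤ K ∧ ∀ f : ℝ → ℂ, ContDiff ℝ 1 f → Function.support f ⊆ Set.Icc (-A) A →
      ∀ F F' : ℝ, (∀ x, ‖f x‖ ≤ F) → (∀ x, ‖deriv f x‖ ≤ F') → ∀ N : ℕ, 1 ≤ N → A ≤ N →
        ‖(∫ x, f x ∂(normPairCorrMeasure a b N)) - ∫ s : ℝ, f s * (pairCorrFun a b s : ℂ)‖ ≤
          K * ((1 + Real.log N) ^ 2 / N) * (F + F') := by
  have hK : ∀ k : ℕ, ∃ K : ℝ, 0 ≤ K ∧ (b ∣ k → 0 < k → ∀ N : ℕ, 1 ≤ N →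
      |totientRatioSum a b k N - mirskyConst a b k * N| ≤ K * (1 + Real.log N) ^ 2) := by
    intro k
    by_cases h : b ∣ k ∧ 0 < k
    · obtain ⟨K, h0, hK⟩ := exists_abs_totientRatioSum_sub_le a k hb h.1 h.2
      exact ⟨K, h0, fun _ _ => hK⟩
    · exact ⟨0, le_rfl, fun h1 h2 => absurd ⟨h1, h2⟩ h⟩
  choose K hK0 hK using hK
  let W : ℕ → ℝ := fun k => 3 * k ^ 2 * (1 + K k + |mirskyConst a b k|)
  have hW0 : ∀ k, 0 ≤ W k := fun k => by have := hK0 k; positivity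
  refine ⟨∑ k ∈ differences b ⌊A⌋₊, 2 * W k,
    Finset.sum_nonneg fun k _ => by have := hW0 k; positivity, ?_⟩
  intro f hf hsupp F F' hF hF' N hN hAN
  have hN0 : (0 : ℝ) < N := by exact_mod_cast hN
  have hl := Real.log_natCast_nonneg N
  have hF0 : 0 ≤ F := (norm_nonneg _).trans (hF 0)
  have hF0' : 0 ≤ F' := (norm_nonneg _).trans (hF' 0)
  have hl1 : 1 ≤ (1 + Real.log N) ^ 2 := by nlinarith
  have main : ∀ k ∈ differences b ⌊A⌋₊, ∀ g : ℝ → ℂ, ContDiff ℝ 1 g → (∀ x, ‖g x‖ ≤ F) →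
      (∀ x, ‖deriv g x‖ ≤ F') →
      ‖((N : ℂ) ^ 3)⁻¹ * corrSum a b k N g -
        (mirskyConst a b k : ℂ) * (k : ℂ) ^ 3 * ∫ s in (k : ℝ)..(N * k : ℝ), g s / (s : ℂ) ^ 4‖ ≤
      W k * ((1 + Real.log N) ^ 2 / N) * (F + F') := by
    intro k hk g hg hgF hgF'
    obtain ⟨⟨hk1, _⟩, hbk⟩ := mem_differences.1 hk
    have hKk := hK0 k
    have h := norm_corrSum_sub_integral_le (a := a) (b := b) (c := mirskyConst a b k)
      (E := K k * (1 + Real.log N) ^ 2) hk1 hN (fun m hm hmN => (hK k hbk hk1 m hm).trans (by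
        have h1 := Real.log_natCast_nonneg m
        have h2 : (0 : ℝ) < m := by exact_mod_cast hm
        have h3 : (m : ℝ) ≤ N := by exact_mod_cast hmN
        gcongr)) hg hgF hgF'
    have hNC : (N : ℂ) ≠ 0 := by exact_mod_cast hN0.ne'
    set J := (mirskyConst a b k : ℂ) * (k : ℂ) ^ 3 *
      ∫ s in (k : ℝ)..(N * k : ℝ), g s / (s : ℂ) ^ 4
    have e : ((N : ℂ) ^ 3)⁻¹ * corrSum a b k N g - J =
        ((N : ℂ) ^ 3)⁻¹ * (corrSum a b k N g - (N : ℂ) ^ 3 * J) := by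
      field_simp
    rw [e, norm_mul, norm_inv, norm_pow, Complex.norm_natCast]
    calc ((N : ℝ) ^ 3)⁻¹ * _ ≤ ((N : ℝ) ^ 3)⁻¹ * (N ^ 2 * (3 * k ^ 2 *
          (1 + K k * (1 + Real.log N) ^ 2 + |mirskyConst a b k|) * (F + F'))) := by gcongr
      _ ≤ ((N : ℝ) ^ 3)⁻¹ * (N ^ 2 * (3 * k ^ 2 *
          (1 * (1 + Real.log N) ^ 2 + K k * (1 + Real.log N) ^ 2 +
            |mirskyConst a b k| * (1 + Real.log N) ^ 2) * (F + F'))) := by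
          gcongr
          · linarith
          · exact le_mul_of_one_le_right (abs_nonneg _) hl1
      _ = _ := by simp only [W]; field_simp
  rw [integral_normPairCorrMeasure_eq_sum a b N hsupp,
    integral_mul_pairCorrFun a b hA hf.continuous hsupp N hAN, Finset.mul_sum,
    ← Finset.sum_sub_distrib, Finset.sum_mul, Finset.sum_mul]
  refine norm_sum_le_of_le _ fun k hk => ?_
  rw [mul_add, add_sub_add_comm]
  refine (norm_add_le _ _).trans ?_
  have h1 := main k hk f hf hF hF'
  have h2 := main k hk (fun s => f (-s)) (hf.comp contDiff_neg) (fun x => hF _) (fun x => by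
    rw [deriv_comp_neg, norm_neg]; exact hF' _)
  linarith

/-! ### From continuously differentiable to continuous test functions -/

/-- Uniform approximation of a continuous function with compact support by its averages over short
intervals, which are continuously differentiable. -/
lemma exists_contDiff_approx {f : ℝ → ℂ} (hf : Continuous f) {A : ℝ}
    (hsupp : Function.support f ⊆ Set.Icc (-A) A) {η : ℝ} (hη : 0 < η) :
    ∃ h : ℝ → ℂ, ContDiff ℝ 1 h ∧ Function.support h ⊆ Set.Icc (-(A + 1)) (A + 1) ∧
      ∀ x, ‖f x - h x‖ ≤ η := by
  have hcs : HasCompactSupport f := HasCompactSupport.of_support_subset_isCompact isCompact_Icc hsupp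
  have huc : UniformContinuous f :=
    hf.uniformContinuous_of_tendsto_cocompact hcs.is_zero_at_infty
  obtain ⟨δ₀, hδ₀, hδf⟩ := Metric.uniformContinuous_iff.1 huc η hη
  let δ := min (δ₀ / 2) 1
  have hδ : 0 < δ := by positivity
  have hδ1 : δ ≤ 1 := min_le_right _ _
  have hδ2 : δ < δ₀ := (min_le_left _ _).trans_lt (by linarith)
  have hz : ∀ s : ℝ, A < |s| → f s = 0 := by
    intro s hs
    by_contra hne
    have := hsupp (Function.mem_support.2 hne)
    exact absurd (abs_le.2 this) (by linarith)
  have hint : ∀ u v : ℝ, IntervalIntegrable f volume u v := fun u v => hf.intervalIntegrable u v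
  let P : ℝ → ℂ := fun x => ∫ t in (0 : ℝ)..x, f t
  have hP : ∀ x, HasDerivAt P (f x) x := fun x =>
    intervalIntegral.integral_hasDerivAt_right (hint 0 x)
      hf.stronglyMeasurable.stronglyMeasurableAtFilter hf.continuousAt
  have hPc : ContDiff ℝ 1 P := by
    refine contDiff_one_iff_deriv.2 ⟨fun x => (hP x).differentiableAt, ?_⟩
    have : deriv P = f := funext fun x => (hP x).deriv
    rw [this]; exact hf
  have hPsub : ∀ x, P (x + δ) - P x = ∫ t in x..(x + δ), f t := fun x =>
    intervalIntegral.integral_interval_sub_left (hint _ _) (hint _ _)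
  refine ⟨fun x => (δ⁻¹ : ℝ) • (P (x + δ) - P x), ?_, ?_, ?_⟩
  · exact ((hPc.comp (contDiff_id.add contDiff_const)).sub hPc).const_smul δ⁻¹
  · intro x hx
    by_contra hcon
    refine hx ?_
    simp only
    rw [hPsub, intervalIntegral.integral_congr (g := fun _ => (0 : ℂ))]
    · simp
    · intro t ht
      rw [Set.uIcc_of_le (by linarith)] at ht
      apply hz
      rw [Set.mem_Icc, not_and_or, not_le, not_le] at hcon
      rcases hcon with h | h
      · rw [lt_abs]; right; linarith [ht.2]
      · rw [lt_abs]; left; linarith [ht.1]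
  · intro x
    have e : f x - (δ⁻¹ : ℝ) • (P (x + δ) - P x) =
        (δ⁻¹ : ℝ) • ∫ t in x..(x + δ), (f x - f t) := by
      rw [intervalIntegral.integral_sub (by simp) (hint _ _), hPsub, smul_sub,
        intervalIntegral.integral_const, add_sub_cancel_left, smul_smul, inv_mul_cancel₀ hδ.ne',
        one_smul]
    have hb : ‖∫ t in x..(x + δ), (f x - f t)‖ ≤ η * |x + δ - x| := by
      refine intervalIntegral.norm_integral_le_of_norm_le_const fun t ht => ?_
      rw [Set.uIoc_of_le (by linarith)] at ht
      rw [← dist_eq_norm]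
      refine (hδf ?_).le
      rw [Real.dist_eq, abs_lt]
      constructor <;> linarith [ht.1, ht.2]
    rw [add_sub_cancel_left, abs_of_pos hδ] at hb
    rw [e, norm_smul, Real.norm_of_nonneg (by positivity)]
    calc δ⁻¹ * _ ≤ δ⁻¹ * (η * δ) := by gcongr
      _ = η := by field_simp

lemma norm_corrSum_le (a b k N : ℕ) {f : ℝ → ℂ} {η : ℝ} (hη : ∀ x, ‖f x‖ ≤ η) :
    ‖corrSum a b k N f‖ ≤ N ^ 3 * η := by
  have hη0 : 0 ≤ η := (norm_nonneg _).trans (hη 0)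
  unfold corrSum
  calc _ ≤ ∑ n ∈ ((Finset.Icc 1 N).filter (fun n => n ≡ a [MOD b])).filter
        (fun n => n + k ≤ N), ((N : ℝ) * N) * η := by
        refine norm_sum_le_of_le _ fun n hn => ?_
        have h1 := (Finset.mem_filter.1 hn).2
        rw [norm_mul, norm_mul, Complex.norm_natCast, Complex.norm_natCast]
        have h2 : Nat.totient n ≤ N := (Nat.totient_le n).trans (by omega)
        have h3 : Nat.totient (n + k) ≤ N := (Nat.totient_le _).trans h1
        have h4 := hη ((N : ℝ) * (Real.log (n + k : ℕ) - Real.log n))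
        gcongr
    _ ≤ N * (((N : ℝ) * N) * η) := by
        rw [Finset.sum_const, nsmul_eq_mul]
        gcongr
        refine (Finset.card_le_card ((Finset.filter_subset _ _).trans
          (Finset.filter_subset _ _))).trans ?_
        simp
    _ = _ := by ring

/-- The measures have bounded mass on compact sets, uniformly in `N`. -/
lemma exists_norm_integral_le (a b : ℕ) {A : ℝ} (hA : 0 ≤ A) :
    ∃ M : ℝ, 0 ≤ M ∧ ∀ f : ℝ → ℂ, Continuous f → Function.support f ⊆ Set.Icc (-A) A →
      ∀ η : ℝ, (∀ x, ‖f x‖ ≤ η) →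
        (∀ N : ℕ, 1 ≤ N → ‖∫ x, f x ∂(normPairCorrMeasure a b N)‖ ≤ M * η) ∧
        ‖∫ s : ℝ, f s * (pairCorrFun a b s : ℂ)‖ ≤ M * η := by
  let B : ℕ := ⌈A⌉₊
  have hB : A ≤ B := Nat.le_ceil A
  refine ⟨∑ k ∈ differences b ⌊A⌋₊, (2 + 2 * (|mirskyConst a b k| * k ^ 3 * (B * k))), ?_, ?_⟩
  · exact Finset.sum_nonneg fun k _ => by positivity
  intro f hf hsupp η hη
  have hη0 : 0 ≤ η := (norm_nonneg _).trans (hη 0)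
  have hη' : ∀ x, ‖f (-x)‖ ≤ η := fun x => hη _
  constructor
  · intro N hN
    have hN0 : (0 : ℝ) < N := by exact_mod_cast hN
    rw [integral_normPairCorrMeasure_eq_sum a b N hsupp, Finset.mul_sum, Finset.sum_mul]
    refine norm_sum_le_of_le _ fun k _ => ?_
    have h1 := norm_corrSum_le a b k N hη
    have h2 := norm_corrSum_le a b k N hη'
    rw [norm_mul, norm_inv, norm_pow, Complex.norm_natCast]
    calc ((N : ℝ) ^ 3)⁻¹ * _ ≤ ((N : ℝ) ^ 3)⁻¹ * (N ^ 3 * η + N ^ 3 * η) := by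
          gcongr
          exact (norm_add_le _ _).trans (add_le_add h1 h2)
      _ = 2 * η := by field_simp; ring
      _ ≤ _ := by
          gcongr
          have : 0 ≤ 2 * (|mirskyConst a b k| * (k : ℝ) ^ 3 * (B * k)) := by positivity
          linarith
  · rw [integral_mul_pairCorrFun a b hA hf hsupp B hB, Finset.sum_mul]
    refine norm_sum_le_of_le _ fun k hk => ?_
    obtain ⟨⟨h1, h2⟩, _⟩ := mem_differences.1 hk
    have hk1 : (1 : ℝ) ≤ k := by exact_mod_cast h1
    have hkA : (k : ℝ) ≤ A := (Nat.le_floor_iff hA).1 h2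
    have hkB : (k : ℝ) ≤ B * k := by nlinarith
    have main : ∀ g : ℝ → ℂ, (∀ x, ‖g x‖ ≤ η) →
        ‖(mirskyConst a b k : ℂ) * (k : ℂ) ^ 3 *
          ∫ s in (k : ℝ)..(B * k : ℝ), g s / (s : ℂ) ^ 4‖ ≤
        |mirskyConst a b k| * k ^ 3 * (η * (B * k)) := by
      intro g hg
      have hint : ‖∫ s in (k : ℝ)..(B * k : ℝ), g s / (s : ℂ) ^ 4‖ ≤ η * |(B : ℝ) * k - k| := by
        refine intervalIntegral.norm_integral_le_of_norm_le_const fun s hs => ?_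
        rw [Set.uIoc_of_le hkB] at hs
        have hs1 : 1 ≤ s := by linarith [hs.1]
        rw [norm_div, norm_pow, Complex.norm_real, Real.norm_of_nonneg (by linarith)]
        exact (div_le_self (norm_nonneg _) (one_le_pow₀ hs1)).trans (hg s)
      rw [norm_mul, norm_mul, norm_pow, Complex.norm_real, Complex.norm_natCast, Real.norm_eq_abs]
      gcongr
      refine hint.trans ?_
      gcongr
      rw [abs_of_nonneg (by linarith)]
      linarith
    refine (norm_add_le _ _).trans ?_
    have m1 := main f hη
    have m2 := main _ hη'
    nlinarith

/-! ### The limit measure -/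

lemma measurable_pairCorrFun (a b : ℕ) : Measurable (pairCorrFun a b) := by
  unfold pairCorrFun
  have h : Measurable ((fun n : ℕ => ∑ k ∈ (Finset.Icc 1 n).filter (fun k => b ∣ k),
      mirskyConst a b k * (k : ℝ) ^ 3) ∘ fun s : ℝ => ⌊|s|⌋₊) :=
    measurable_from_nat.comp (Nat.measurable_floor.comp measurable_id.abs)
  exact (measurable_const.div (measurable_id.pow_const 4)).mul h

lemma mirskyConst_mul_nonneg (a : ℕ) {b k n : ℕ} (hb : 0 < b)
    (hk : k ∈ (Finset.Icc 1 n).filter (fun k => b ∣ k)) :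
    0 ≤ mirskyConst a b k * (k : ℝ) ^ 3 :=
  mul_nonneg (mirskyConst_nonneg a k hb (Finset.mem_filter.1 hk).2) (by positivity)

lemma pairCorrFun_nonneg (a : ℕ) {b : ℕ} (hb : 0 < b) (s : ℝ) : 0 ≤ pairCorrFun a b s :=
  mul_nonneg (by positivity) (Finset.sum_nonneg fun _ hk => mirskyConst_mul_nonneg a hb hk)

lemma pairCorrFun_le (a : ℕ) {b : ℕ} (hb : 0 < b) {s : ℝ} {R : ℕ} (hs : |s| ≤ R) :
    pairCorrFun a b s ≤ ∑ k ∈ (Finset.Icc 1 R).filter (fun k => b ∣ k),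
      mirskyConst a b k * (k : ℝ) ^ 3 := by
  have hR : ⌊|s|⌋₊ ≤ R := by
    have := Nat.floor_le_floor hs
    simpa using this
  have h1 : ∑ k ∈ (Finset.Icc 1 ⌊|s|⌋₊).filter (fun k => b ∣ k), mirskyConst a b k * (k : ℝ) ^ 3 ≤
      ∑ k ∈ (Finset.Icc 1 R).filter (fun k => b ∣ k), mirskyConst a b k * (k : ℝ) ^ 3 :=
    Finset.sum_le_sum_of_subset_of_nonneg
      (Finset.filter_subset_filter _ (Finset.Icc_subset_Icc le_rfl hR))
      fun k hk _ => mirskyConst_mul_nonneg a hb hk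
  unfold pairCorrFun
  by_cases h : 1 ≤ |s|
  · have h4 : 1 ≤ s ^ 4 := by
      have e : s ^ 4 = |s| ^ 4 := ((by decide : Even 4).pow_abs s).symm
      rw [e]; exact one_le_pow₀ h
    have h5 : 1 / s ^ 4 ≤ 1 := (div_le_one (by linarith)).2 h4
    exact (mul_le_of_le_one_left (Finset.sum_nonneg fun _ hk => mirskyConst_mul_nonneg a hb hk)
      h5).trans h1
  · have : ⌊|s|⌋₊ = 0 := Nat.floor_eq_zero.2 (not_le.1 h)
    rw [this]
    simpa using Finset.sum_nonneg fun k (hk : k ∈ (Finset.Icc 1 R).filter (fun k => b ∣ k)) =>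
      mirskyConst_mul_nonneg a hb hk

lemma isLocallyFiniteMeasure_densityMeasure (a : ℕ) {b : ℕ} (hb : 0 < b) :
    IsLocallyFiniteMeasure (densityMeasure (pairCorrFun a b)) := by
  refine ⟨fun x => ⟨Set.Ioo (x - 1) (x + 1), Ioo_mem_nhds (by linarith) (by linarith), ?_⟩⟩
  unfold densityMeasure
  rw [withDensity_apply _ measurableSet_Ioo]
  obtain ⟨R, hR⟩ := exists_nat_ge (|x| + 1)
  refine lt_of_le_of_lt (setLIntegral_mono (g := fun _ => ENNReal.ofReal
    (∑ k ∈ (Finset.Icc 1 R).filter (fun k => b ∣ k), mirskyConst a b k * (k : ℝ) ^ 3))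
    measurable_const fun s hs => ?_) ?_
  · refine ENNReal.ofReal_le_ofReal (pairCorrFun_le a hb ?_)
    have h1 : |s - x| ≤ 1 := by rw [abs_le]; constructor <;> linarith [hs.1, hs.2]
    have h2 : |s| ≤ |s - x| + |x| := by simpa using abs_add_le (s - x) x
    linarith
  · rw [setLIntegral_const]
    exact ENNReal.mul_lt_top ENNReal.ofReal_lt_top (by simp)

lemma integral_densityMeasure (a : ℕ) {b : ℕ} (hb : 0 < b) (f : ℝ → ℂ) :
    ∫ x, f x ∂(densityMeasure (pairCorrFun a b)) = ∫ s : ℝ, f s * (pairCorrFun a b s : ℂ) := by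
  unfold densityMeasure
  rw [integral_withDensity_eq_integral_toReal_smul (measurable_pairCorrFun a b).ennreal_ofReal
    (.of_forall fun _ => ENNReal.ofReal_lt_top)]
  refine integral_congr_ae (.of_forall fun s => ?_)
  simp only
  rw [ENNReal.toReal_ofReal (pairCorrFun_nonneg a hb s), Complex.real_smul, mul_comm]

lemma isFiniteMeasure_normPairCorrMeasure (a b N : ℕ) :
    IsFiniteMeasure (normPairCorrMeasure a b N) := by
  unfold normPairCorrMeasure pairCorrMeasure
  infer_instance

theorem weakStarTendsto_normPairCorrMeasure (a : ℕ) {b : ℕ} (hb : 0 < b) :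
    WeakStarTendsto (normPairCorrMeasure a b) (densityMeasure (pairCorrFun a b)) := by
  refine ⟨fun N => ?_, isLocallyFiniteMeasure_densityMeasure a hb, fun f hf hcs => ?_⟩
  · have := isFiniteMeasure_normPairCorrMeasure a b N
    infer_instance
  obtain ⟨A, hA0, hA⟩ := hcs.isCompact.isBounded.subset_closedBall_lt 0 0
  have hsupp : Function.support f ⊆ Set.Icc (-A) A := by
    refine (subset_tsupport f).trans (hA.trans ?_)
    rw [Real.closedBall_eq_Icc]
    simp
  rw [integral_densityMeasure a hb, Metric.tendsto_atTop]
  intro ε hε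
  have hB0 : 0 ≤ A + 1 := by linarith
  obtain ⟨M, hM0, hM⟩ := exists_norm_integral_le a b hB0
  obtain ⟨K, hK0, hK⟩ := exists_norm_integral_sub_le a hb hB0
  obtain ⟨h, hh, hhs, hfh⟩ := exists_contDiff_approx hf hsupp
    (η := ε / (4 * (M + 1))) (by positivity)
  have hhc : HasCompactSupport h := HasCompactSupport.of_support_subset_isCompact isCompact_Icc hhs
  obtain ⟨F, hF⟩ := hhc.exists_bound_of_continuous hh.continuous
  obtain ⟨F', hF'⟩ := hhc.deriv.exists_bound_of_continuous (hh.continuous_deriv le_rfl)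
  have hsd : Function.support (fun x => f x - h x) ⊆ Set.Icc (-(A + 1)) (A + 1) := by
    refine (Function.support_sub f h).trans (Set.union_subset (hsupp.trans ?_) hhs)
    exact Set.Icc_subset_Icc (by linarith) (by linarith)
  obtain ⟨hd1, hd2⟩ := hM (fun x => f x - h x) (hf.sub hh.continuous) hsd _ hfh
  have hMη : M * (ε / (4 * (M + 1))) ≤ ε / 4 := by
    rw [mul_div_assoc', div_le_div_iff₀ (by positivity) (by norm_num)]
    nlinarith
  have hlim := (tendsto_one_add_log_sq_div.const_mul K).mul_const (F + F')
  rw [mul_zero, zero_mul] at hlim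
  have hev := (hlim.eventually (gt_mem_nhds (show 0 < ε / 4 by positivity))).and
    ((eventually_ge_atTop 1).and (tendsto_natCast_atTop_atTop.eventually_ge_atTop (A + 1)))
  obtain ⟨N₀, hN₀⟩ := eventually_atTop.1 hev
  refine ⟨N₀, fun N hN => ?_⟩
  obtain ⟨h1, h2, h3⟩ := hN₀ N hN
  have hmain := hK h hh hhs F F' hF hF' N h2 h3
  have hd1' := hd1 N h2
  have := isFiniteMeasure_normPairCorrMeasure a b N
  have hloc := isLocallyFiniteMeasure_densityMeasure a hb
  have e1 : ∫ x, (f x - h x) ∂(normPairCorrMeasure a b N) =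
      ∫ x, f x ∂(normPairCorrMeasure a b N) - ∫ x, h x ∂(normPairCorrMeasure a b N) :=
    integral_sub (hf.integrable_of_hasCompactSupport hcs)
      (hh.continuous.integrable_of_hasCompactSupport hhc)
  have e2 : ∫ s : ℝ, (f s - h s) * (pairCorrFun a b s : ℂ) =
      (∫ s : ℝ, f s * (pairCorrFun a b s : ℂ)) - ∫ s : ℝ, h s * (pairCorrFun a b s : ℂ) := by
    rw [← integral_densityMeasure a hb f, ← integral_densityMeasure a hb h,
      ← integral_densityMeasure a hb (fun s => f s - h s)]
    exact integral_sub (hf.integrable_of_hasCompactSupport hcs)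
      (hh.continuous.integrable_of_hasCompactSupport hhc)
  rw [e1] at hd1'
  rw [e2] at hd2
  set I1 := ∫ x, f x ∂(normPairCorrMeasure a b N)
  set I2 := ∫ x, h x ∂(normPairCorrMeasure a b N)
  set J1 := ∫ s : ℝ, f s * (pairCorrFun a b s : ℂ)
  set J2 := ∫ s : ℝ, h s * (pairCorrFun a b s : ℂ)
  rw [dist_eq_norm]
  have e : I1 - J1 = (I1 - I2) + (I2 - J2) - (J1 - J2) := by ring
  rw [e]
  have t1 := norm_sub_le ((I1 - I2) + (I2 - J2)) (J1 - J2)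
  have t2 := norm_add_le (I1 - I2) (I2 - J2)
  linarith

/-! ### The error term for large `N` -/

/-- The powers of `N` and the logarithms that separate `log ^ 2 N / N` from the two terms of the
error bound absorb any constant, once `N` is large. -/
lemma eventually_error_le (K : ℝ) {α : ℝ} (hα : 0 < α) (hα1 : α < 1) :
    ∀ᶠ N : ℕ in atTop, K * ((1 + Real.log N) ^ 2 / N) ≤ Real.log N ^ 2 / (N : ℝ) ^ (1 - α) ∧
      K * ((1 + Real.log N) ^ 2 / N) ≤ 1 / (N : ℝ) ^ α := by
  have h1 : ∀ᶠ x : ℝ in atTop, 1 ≤ Real.log x := Real.tendsto_log_atTop.eventually_ge_atTop 1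
  have h2 : ∀ᶠ x : ℝ in atTop, 4 * |K| ≤ x ^ α :=
    (tendsto_rpow_atTop hα).eventually_ge_atTop _
  have h3 : ∀ᶠ x : ℝ in atTop, ‖Real.log x ^ (2 : ℝ)‖ ≤ (4 * |K| + 1)⁻¹ * ‖x ^ (1 - α)‖ :=
    (isLittleO_log_rpow_rpow_atTop 2 (show 0 < 1 - α by linarith)).bound (by positivity)
  have h := tendsto_natCast_atTop_atTop.eventually (h1.and (h2.and (h3.and (eventually_gt_atTop 0))))
  filter_upwards [h] with N ⟨g1, g2, g3, g4⟩
  have hp1 : 0 < (N : ℝ) ^ α := Real.rpow_pos_of_pos g4 _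
  have hp2 : 0 < (N : ℝ) ^ (1 - α) := Real.rpow_pos_of_pos g4 _
  have hN : (N : ℝ) ^ α * (N : ℝ) ^ (1 - α) = N := by
    rw [← Real.rpow_add g4]; simp
  rw [Real.rpow_two, Real.norm_of_nonneg (sq_nonneg _), Real.norm_of_nonneg hp2.le,
    inv_mul_eq_div, le_div_iff₀ (by positivity)] at g3
  have hl : (1 + Real.log N) ^ 2 ≤ 4 * Real.log N ^ 2 := by nlinarith
  have hKl : K * ((1 + Real.log N) ^ 2 / N) ≤ 4 * |K| * Real.log N ^ 2 / N := by
    rw [← mul_div_assoc]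
    refine div_le_div_of_nonneg_right ?_ g4.le
    calc K * (1 + Real.log N) ^ 2 ≤ |K| * (4 * Real.log N ^ 2) := by
          gcongr
          exact le_abs_self K
      _ = _ := by ring
  constructor
  · refine hKl.trans ?_
    rw [div_le_div_iff₀ g4 hp2]
    calc 4 * |K| * Real.log N ^ 2 * (N : ℝ) ^ (1 - α)
        ≤ (N : ℝ) ^ α * Real.log N ^ 2 * (N : ℝ) ^ (1 - α) := by gcongr
      _ = Real.log N ^ 2 * ((N : ℝ) ^ α * (N : ℝ) ^ (1 - α)) := by ring
      _ = _ := by rw [hN]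
  · refine hKl.trans ?_
    rw [div_le_div_iff₀ g4 hp1, one_mul]
    calc 4 * |K| * Real.log N ^ 2 * (N : ℝ) ^ α
        ≤ (N : ℝ) ^ (1 - α) * (N : ℝ) ^ α := by
          gcongr
          nlinarith [sq_nonneg (Real.log N)]
      _ = _ := by rw [mul_comm, hN]

theorem exists_norm_integral_sub_le_error (a : ℕ) {b : ℕ} (hb : 0 < b) {A : ℝ} (hA : 1 ≤ A)
    {α : ℝ} (hα : 0 < α) (hα1 : α < 1) :
    ∃ N₀ : ℕ, ∀ f : ℝ → ℂ, ContDiff ℝ 1 f → Function.support f ⊆ Set.Icc (-A) A →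
      ∀ N : ℕ, N₀ ≤ N →
        ‖(∫ x, f x ∂(normPairCorrMeasure a b N)) - ∫ s : ℝ, f s * (pairCorrFun a b s : ℂ)‖ ≤
          A ^ 7 * Real.log N ^ 2 / (N : ℝ) ^ (1 - α) * (⨆ x : ℝ, ‖f x‖) +
            A ^ 3 / (N : ℝ) ^ α * (⨆ x : ℝ, ‖deriv f x‖) := by
  obtain ⟨K, _, hK⟩ := exists_norm_integral_sub_le a hb (show 0 ≤ A by linarith)
  obtain ⟨N₀, hN₀⟩ := eventually_atTop.1 ((eventually_error_le K hα hα1).and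
    ((eventually_ge_atTop 1).and (tendsto_natCast_atTop_atTop.eventually_ge_atTop A)))
  refine ⟨N₀, fun f hf hsupp N hN => ?_⟩
  obtain ⟨⟨h1, h2⟩, h3, h4⟩ := hN₀ N hN
  have hcs : HasCompactSupport f := HasCompactSupport.of_support_subset_isCompact isCompact_Icc hsupp
  -- the suprema are genuine ones, the functions being continuous with compact support
  have hF : ∀ x, ‖f x‖ ≤ ⨆ x : ℝ, ‖f x‖ := fun x =>
    le_ciSup (hf.continuous.norm.bddAbove_range_of_hasCompactSupport hcs.norm) x
  have hF' : ∀ x, ‖deriv f x‖ ≤ ⨆ x : ℝ, ‖deriv f x‖ := fun x =>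
    le_ciSup ((hf.continuous_deriv le_rfl).norm.bddAbove_range_of_hasCompactSupport
      hcs.deriv.norm) x
  have hF0 := (norm_nonneg _).trans (hF 0)
  have hF0' := (norm_nonneg _).trans (hF' 0)
  refine (hK f hf hsupp _ _ hF hF' N h3 h4).trans ?_
  have hA7 : 1 ≤ A ^ 7 := one_le_pow₀ hA
  have hA3 : 1 ≤ A ^ 3 := one_le_pow₀ hA
  rw [mul_add]
  refine add_le_add (mul_le_mul_of_nonneg_right (h1.trans ?_) hF0)
    (mul_le_mul_of_nonneg_right (h2.trans ?_) hF0')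
  · gcongr
    exact le_mul_of_one_le_left (sq_nonneg _) hA7
  · gcongr

/-! ### Mirsky's constants -/

theorem mirskyConst_one_one {k : ℕ} (hk : 1 ≤ k) : mirskyConst 1 1 k = mirskyProduct k := by
  classical
  obtain ⟨h1, h2⟩ := multipliable_mirskyFactor 1 1 k one_pos
  have e : mirskyConst 1 1 k =
      ∏' p : Nat.Primes, mirskyFactor₁ 1 1 k p * mirskyFactor₂ 1 1 k p := by
    rw [h1.tprod_mul h2]
    unfold mirskyConst
    rw [Nat.cast_one, div_one, one_mul]
    rfl
  let u : ℕ → ℝ := fun p => 1 + 1 / ((p : ℝ) * ((p : ℝ) ^ 2 - 2))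
  have hfac : ∀ p : Nat.Primes, mirskyFactor₁ 1 1 k p * mirskyFactor₂ 1 1 k p =
      (1 - 2 / ((p : ℕ) : ℝ) ^ 2) * (if (p : ℕ) ∣ k then u p else 1) := by
    intro p
    have hp1 : ¬ (p : ℕ) ∣ 1 := by
      rw [Nat.dvd_one]; exact p.2.one_lt.ne'
    have hp2 : (2 : ℝ) ≤ ((p : ℕ) : ℝ) := by exact_mod_cast p.2.two_le
    have hp3 : ((p : ℕ) : ℝ) ^ 2 - 2 ≠ 0 := by nlinarith
    have hp4 : ((p : ℕ) : ℝ) ≠ 0 := by linarith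
    rw [← localMean_primeFactorTerm 1 1 k (one_dvd k) p.2, localMean, if_neg hp1,
      sum_primeFactorTerm k p.2]
    simp only [u]
    split_ifs
    · field_simp
    · ring
  let S : Finset Nat.Primes := k.primeFactors.subtype Nat.Prime
  have hS : ∀ p ∉ S, (if ((p : Nat.Primes) : ℕ) ∣ k then u p else 1) = 1 := by
    intro p hp
    refine if_neg fun hpk => hp ?_
    exact Finset.mem_subtype.2 (Nat.mem_primeFactors.2 ⟨p.2, hpk, by omega⟩)
  have hm : Multipliable fun p : Nat.Primes => 1 - 2 / ((p : ℕ) : ℝ) ^ 2 := by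
    have := multipliable_one_add_of_summable (f := fun p : Nat.Primes => -2 / ((p : ℕ) : ℝ) ^ 2)
      (((summable_primes_inv_sq.mul_left 2)).congr fun p => by
        rw [norm_div, norm_neg, norm_pow]
        simp
        ring)
    refine this.congr fun p => ?_
    ring
  rw [e, tprod_congr hfac, hm.tprod_mul (hasProd_prod_of_ne_finset_one hS).multipliable,
    tprod_eq_prod hS, mirskyProduct]
  congr 1
  have hprod : ∏ p ∈ S, (if ((p : Nat.Primes) : ℕ) ∣ k then u p else 1) =
      ∏ p ∈ k.primeFactors, (if p ∣ k then u p else 1) :=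
    Finset.prod_subtype_of_mem (fun p => if p ∣ k then u p else 1)
      fun p hp => Nat.prime_of_mem_primeFactors hp
  rw [hprod]
  exact Finset.prod_congr rfl fun p hp => if_pos (Nat.dvd_of_mem_primeFactors hp)

lemma pairCorrFun_one_one : pairCorrFun 1 1 = fun s : ℝ =>
    1 / s ^ 4 * (∏' p : Nat.Primes, (1 - 2 / (p : ℝ) ^ 2)) *
      ∑ k ∈ Finset.Icc 1 ⌊|s|⌋₊,
        (k : ℝ) ^ 3 * ∏ p ∈ k.primeFactors, (1 + 1 / ((p : ℝ) * ((p : ℝ) ^ 2 - 2))) := by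
  funext s
  unfold pairCorrFun
  rw [mul_assoc, Finset.filter_true_of_mem fun k _ => one_dvd k]
  congr 1
  rw [Finset.mul_sum]
  refine Finset.sum_congr rfl fun k hk => ?_
  rw [mirskyConst_one_one (Finset.mem_Icc.1 hk).1, mirskyProduct]
  ring

end LogPairs

theorem theorem5p1 :
    -- weak-star convergence
    (∀ a b : ℕ, 1 ≤ a → a ≤ b →
      LogPairs.WeakStarTendsto (LogPairs.normPairCorrMeasure a b)
        (LogPairs.densityMeasure (LogPairs.pairCorrFun a b))) ∧
    -- error term, with an implied constant depending only on `b`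
    (∀ b : ℕ, 1 ≤ b → ∃ C : ℝ, ∀ a : ℕ, 1 ≤ a → a ≤ b →
      ∀ A : ℝ, 1 ≤ A → ∀ α : ℝ, 1 / 2 ≤ α → α < 1 →
      ∃ N₀ : ℕ, ∀ f : ℝ → ℂ, ContDiff ℝ 1 f → Function.support f ⊆ Set.Icc (-A) A →
      ∀ N : ℕ, N₀ ≤ N →
        ‖(∫ x, f x ∂(LogPairs.normPairCorrMeasure a b N)) -
            ∫ s : ℝ, f s * (LogPairs.pairCorrFun a b s : ℂ)‖ ≤
          C * (A ^ 7 * Real.log N ^ 2 / (N : ℝ) ^ (1 - α) * (⨆ x : ℝ, ‖f x‖) +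
            A ^ 3 / (N : ℝ) ^ α * (⨆ x : ℝ, ‖deriv f x‖))) ∧
    -- the case `a = b = 1`: Mirsky's value of the constants, and the resulting limit
    (∀ k : ℕ, 1 ≤ k → LogPairs.mirskyConst 1 1 k = LogPairs.mirskyProduct k) ∧
    LogPairs.WeakStarTendsto (LogPairs.normPairCorrMeasure 1 1)
      (LogPairs.densityMeasure fun s : ℝ =>
        1 / s ^ 4 * (∏' p : Nat.Primes, (1 - 2 / (p : ℝ) ^ 2)) *
          ∑ k ∈ Finset.Icc 1 ⌊|s|⌋₊,
            (k : ℝ) ^ 3 * ∏ p ∈ k.primeFactors, (1 + 1 / ((p : ℝ) * ((p : ℝ) ^ 2 - 2)))) := by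
  refine ⟨fun a b ha hab => LogPairs.weakStarTendsto_normPairCorrMeasure a (by omega), ?_,
    fun k hk => LogPairs.mirskyConst_one_one hk, ?_⟩
  · -- the constant is `1`: all the implied constants are absorbed in the choice of `N₀`
    intro b hb
    refine ⟨1, fun a _ _ A hA α hα hα1 => ?_⟩
    simp only [one_mul]
    exact LogPairs.exists_norm_integral_sub_le_error a hb hA (by linarith) hα1
  · rw [← LogPairs.pairCorrFun_one_one]
    exact LogPairs.weakStarTendsto_normPairCorrMeasure 1 one_pos
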